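/- Let $p,q,n$ be positive integers and $a,b\in\{1,-1\}$, with $p\neq1$ when $a^nb=1$, and $q\neq1$ when $a=1$. Then \[ \int_0^\infty\frac{\ln^{q-1}(x)\operatorname{Li}_p(bx^{2n})}{1-ax^2}\,\mathrm dx =-a^{n-1}b\,2^{-q}(q-1)!\,(1+a(-1)^q)\,\Phi(a,q,\tfrac12)\,\Phi(a^nb,p,1) \] \[ +\,a^{n-1}b\,(2n)^{-q}(q-1)!\sum_{j=1}^{n}\sum_{k=1}^{q}\binom{p+q-k-1}{p-1}a^j(-1)^k\,\Theta(b,k,2j-1,2n)\,\Phi\!\left(a^nb,\,p+q-k,\,\frac{2n-2j+1}{2n}\right). \] Here $\Phi(c,q,\alpha)=\sum_{m=0}^\infty \frac{c^m}{(m+\alpha)^q}$ is the Lerch transcendent (for $c=-1$, $q=1$ the sum is the limit of the partial sums); \[ \Theta(c,q,s,r)=\Phi\!\left(c,q,\tfrac sr\right)+c(-1)^q\,\Phi\!\left(c,q,\tfrac{r-s}{r}\right)\ \text{ if }(c,q)\ne(1,1),\qquad \Theta(1,1,s,r)=\pi\cot\!\left(\tfrac{\pi s}{r}\right); \] and \[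 \operatorname{Li}_p(x)=\frac{(-1)^{p-1}}{(p-1)!}\int_0^1\frac{x\ln^{p-1}(y)}{1-xy}\,\mathrm dy , \] where for $x>1$ (which occurs only when $b=1$) the integral is the Cauchy principal value at $y=1/x$. With this reading of $\operatorname{Li}_p$, the integral over $x\in(0,\infty)$ on the left converges absolutely. -/

import Mathlib

open Filter Topology MeasureTheory

noncomputable section

/-- The Lerch transcendent `Φ(c, q, α) = ∑_{m ≥ 0} c ^ m / (m + α) ^ q` of an integer order `q`,
as the limit of the partial sums (the series converges only conditionally for `c = -1`, `q = 1`). -/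
def lerchPhi (c : ℝ) (q : ℕ) (α : ℝ) : ℝ :=
  limUnder atTop (fun N : ℕ => ∑ m ∈ Finset.range N, c ^ m / ((m : ℝ) + α) ^ q)

/-- `Θ(c, q, s, r) = Φ(c, q, s / r) + c (-1) ^ q Φ(c, q, (r - s) / r)`. For `c = q = 1`, where the
two series diverge separately, `Θ(1, 1, s, r) = π cot (π s / r)`. -/
def lerchTheta (c : ℝ) (q : ℕ) (s r : ℝ) : ℝ :=
  if c = 1 ∧ q = 1 then Real.pi * Real.cot (Real.pi * s / r)
  else lerchPhi c q (s / r) + c * (-1) ^ q * lerchPhi c q ((r - s) / r)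

/-- Cauchy principal value of `∫_u^v f` with a singularity at the interior point `w`. -/
def cauchyPV (f : ℝ → ℝ) (u w v : ℝ) : ℝ :=
  limUnder (𝓝[>] (0 : ℝ))
    (fun ε : ℝ => (∫ y in u..(w - ε), f y) + ∫ y in (w + ε)..v, f y)

/-- The real polylogarithm of order `p ≥ 1`,
`Li_p(x) = (-1) ^ (p - 1) / (p - 1)! * ∫_0^1 x ln ^ (p - 1) (y) / (1 - x y) dy`,
where for `x > 1` the integral is the Cauchy principal value at `y = 1 / x`. -/
def polylog (p : ℕ) (x : ℝ) : ℝ :=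
  (-1) ^ (p - 1) / (Nat.factorial (p - 1) : ℝ) *
    if x ≤ 1 then ∫ y in (0 : ℝ)..1, x * Real.log y ^ (p - 1) / (1 - x * y)
    else cauchyPV (fun y => x * Real.log y ^ (p - 1) / (1 - x * y)) 0 (1 / x) 1

end

/-!
Substituting `x = e ^ (β σ)` with `β = 1 / (2 n)` in the integral and `y = e ^ (-τ)` in the
definition of `Li_p` turns the left-hand side into a multiple of
`∫ g(σ) (PV ∫_{τ > 0} τ ^ (p - 1) k(σ - τ) dτ) dσ`, where
`g(σ) = σ ^ (q - 1) e ^ (β σ) / (1 - a e ^ (2 β σ))` and `k(w) = 1 / (e ^ (-w) - b)`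
(`logKernel`). Once the order of integration is exchanged, the inner integral
`PV ∫ g(σ) k(σ - τ) dσ` is elementary: by partial fractions in `e ^ (2 β σ)`
(`partial_fractions`) it splits into the integral of `g` and integrals of
`(τ + w) ^ (q - 1) e ^ (α w) / (1 - b e ^ w)` over the real line, whose binomial expansion produces
the values of `Θ` (`integral_theta_integrand`). Integrating against `τ ^ (p - 1)` and expanding
geometric series gives the values of `Φ` (`lerchPhi_eq_integral`).

The analytic point is the exchange when `b = 1` and `k` has a pole at `0`. Since
`k(w) + k(-w) = -b`, folding an integral at the pole, `w ↦ σ ± w` with `w > 0`, replaces the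
principal value by an absolutely convergent integral in which `k` only multiplies a difference of
two values. This is done on both sides. On the side of `Li_p` (`foldedPow`,
`polylog_eq_integral_foldedPow`) the difference is that of the truncated power `τ ^ (p - 1)`, which
for `p = 1` has a jump at `0`; on the side of `g` it is controlled by the mean value theorem and the
exponential decay of `g'` (`ExpDecay.abs_sub_le`). In both cases the integrand over the two variables
is dominated by products of integrable functions of one variable, so Fubini's theorem applies, and
for fixed `w` the two sides are related by a translation (`ExpDecay.integral_mul_polylog`).
-/

/-! ### Integral representations of `Φ` and `Θ` -/

theorem integrableOn_pow_mul_exp_neg (k : ℕ) {c : ℝ} (hc : 0 < c) :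
    IntegrableOn (fun w : ℝ => w ^ k * Real.exp (-(c * w))) (Set.Ioi 0) := by
  have h := integrableOn_rpow_mul_exp_neg_mul_rpow (p := 1) (s := (k : ℝ)) (b := c)
    (by have := Nat.cast_nonneg (α := ℝ) k; linarith) one_pos hc
  refine h.congr_fun (fun w _ => ?_) measurableSet_Ioi
  simp [Real.rpow_natCast]

theorem integral_pow_mul_exp_neg (k : ℕ) {c : ℝ} (hc : 0 < c) :
    ∫ w in Set.Ioi (0 : ℝ), w ^ k * Real.exp (-(c * w)) = (Nat.factorial k : ℝ) / c ^ (k + 1) := by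
  have h := Real.integral_rpow_mul_exp_neg_mul_Ioi (a := (k : ℝ) + 1) (r := c) (by positivity) hc
  rw [Real.Gamma_nat_eq_factorial] at h
  rw [show (fun w : ℝ => w ^ k * Real.exp (-(c * w))) =
    fun w : ℝ => w ^ ((k : ℝ) + 1 - 1) * Real.exp (-(c * w)) by
      ext w; rw [add_sub_cancel_right, Real.rpow_natCast], h]
  rw [show (k : ℝ) + 1 = ((k + 1 : ℕ) : ℝ) by push_cast; rfl, Real.rpow_natCast]
  rw [one_div, inv_pow]; field_simp

theorem one_sub_sign_mul_exp_neg_pos {c w : ℝ} (hc : c = 1 ∨ c = -1) (hw : 0 < w) :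
    0 < 1 - c * Real.exp (-w) := by
  have h1 : Real.exp (-w) < 1 := Real.exp_lt_one_iff.2 (by linarith)
  have h2 := Real.exp_pos (-w)
  rcases hc with rfl | rfl <;> linarith

theorem inv_one_sub_sign_mul_exp_neg_le {c w : ℝ} (hc : c = 1 ∨ c = -1) (hw : 0 < w) :
    (1 - c * Real.exp (-w))⁻¹ ≤ 1 + w⁻¹ := by
  have h0 := one_sub_sign_mul_exp_neg_pos hc hw
  have h1 : Real.exp (-w) ≤ (1 + w)⁻¹ := by
    rw [Real.exp_neg]
    exact inv_anti₀ (by linarith) (by linarith [Real.add_one_le_exp w])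
  have h3 : w / (1 + w) ≤ 1 - c * Real.exp (-w) := by
    have e : w / (1 + w) = 1 - (1 + w)⁻¹ := by field_simp; ring
    have h2 := Real.exp_pos (-w)
    rw [e]
    rcases hc with rfl | rfl <;> nlinarith
  calc (1 - c * Real.exp (-w))⁻¹ ≤ (w / (1 + w))⁻¹ := inv_anti₀ (by positivity) h3
    _ = 1 + w⁻¹ := by field_simp; ring

/-- The integrand of `Γ(k) Φ(c, k, α)`. Only for `c = k = 1` does the pole of
`1 / (1 - c e ^ (-w))` at `w = 0` destroy integrability. -/
theorem integrableOn_lerch_integrand {c : ℝ} (hc : c = 1 ∨ c = -1) {k : ℕ} (hk : 1 ≤ k)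
    (h : ¬ (c = 1 ∧ k = 1)) {α : ℝ} (hα : 0 < α) :
    IntegrableOn (fun w : ℝ => w ^ (k - 1) * Real.exp (-(α * w)) / (1 - c * Real.exp (-w)))
      (Set.Ioi 0) := by
  have hm : AEStronglyMeasurable
      (fun w : ℝ => w ^ (k - 1) * Real.exp (-(α * w)) / (1 - c * Real.exp (-w)))
      (volume.restrict (Set.Ioi 0)) := by
    apply Measurable.aestronglyMeasurable; fun_prop
  rcases hc with rfl | rfl
  · obtain ⟨m, rfl⟩ : ∃ m, k = m + 2 := ⟨k - 2, by have : k ≠ 1 := fun e => h ⟨rfl, e⟩; omega⟩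
    refine Integrable.mono' ((integrableOn_pow_mul_exp_neg (m + 1) hα).add
      (integrableOn_pow_mul_exp_neg m hα)) hm ?_
    refine (ae_restrict_iff' measurableSet_Ioi).2 (Eventually.of_forall fun w (hw : 0 < w) => ?_)
    have h1 := inv_one_sub_sign_mul_exp_neg_le (Or.inl rfl : (1 : ℝ) = 1 ∨ (1 : ℝ) = -1) hw
    have h0 := one_sub_sign_mul_exp_neg_pos (Or.inl rfl : (1 : ℝ) = 1 ∨ (1 : ℝ) = -1) hw
    rw [Real.norm_of_nonneg (by positivity), div_eq_mul_inv]
    calc w ^ (m + 2 - 1) * Real.exp (-(α * w)) * (1 - 1 * Real.exp (-w))⁻¹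
        ≤ w ^ (m + 2 - 1) * Real.exp (-(α * w)) * (1 + w⁻¹) := by gcongr
      _ = _ := by
        simp only [Nat.add_succ_sub_one, Pi.add_apply, pow_succ]; field_simp
  · refine Integrable.mono' (integrableOn_pow_mul_exp_neg (k - 1) hα) hm ?_
    refine (ae_restrict_iff' measurableSet_Ioi).2 (Eventually.of_forall fun w (hw : 0 < w) => ?_)
    have h0 := one_sub_sign_mul_exp_neg_pos (Or.inr rfl : (-1 : ℝ) = 1 ∨ (-1 : ℝ) = -1) hw
    rw [Real.norm_of_nonneg (by positivity)]
    refine div_le_self (by positivity) ?_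
    have := Real.exp_pos (-w)
    linarith

/-- Dominated convergence for finite geometric sums: if `F / (1 - c e ^ (-w))` is integrable, the
integral of `F` times the `N`-th partial sum of `∑ (c e ^ (-w)) ^ m` converges to its integral. -/
theorem tendsto_integral_mul_geom_sum {c : ℝ} (hc : c = 1 ∨ c = -1) {F : ℝ → ℝ}
    (hF : IntegrableOn (fun w => F w / (1 - c * Real.exp (-w))) (Set.Ioi 0)) :
    Tendsto (fun N : ℕ => ∫ w in Set.Ioi (0 : ℝ),
        F w * ∑ m ∈ Finset.range N, (c * Real.exp (-w)) ^ m) atTop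
      (𝓝 (∫ w in Set.Ioi (0 : ℝ), F w / (1 - c * Real.exp (-w)))) := by
  have habs : ∀ w : ℝ, 0 < w → |c * Real.exp (-w)| < 1 := by
    intro w hw
    have h1 : Real.exp (-w) < 1 := Real.exp_lt_one_iff.2 (by linarith)
    have h2 := Real.exp_pos (-w)
    rcases hc with rfl | rfl <;> rw [abs_lt] <;> constructor <;> linarith
  have key : ∀ N : ℕ, ∫ w in Set.Ioi (0 : ℝ),
        F w * ∑ m ∈ Finset.range N, (c * Real.exp (-w)) ^ m =
      ∫ w in Set.Ioi (0 : ℝ), F w / (1 - c * Real.exp (-w)) * (1 - (c * Real.exp (-w)) ^ N) := by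
    intro N
    refine setIntegral_congr_fun measurableSet_Ioi fun w (hw : 0 < w) => ?_
    have h0 := (one_sub_sign_mul_exp_neg_pos hc hw).ne'
    have h1 := mul_neg_geom_sum (c * Real.exp (-w)) N
    rw [← h1]; field_simp
  simp_rw [key]
  refine tendsto_integral_of_dominated_convergence
    (fun w => ‖F w / (1 - c * Real.exp (-w))‖ * 2) ?_ (hF.norm.mul_const 2) ?_ ?_
  · intro N
    refine hF.aestronglyMeasurable.mul (Measurable.aestronglyMeasurable ?_)
    fun_prop
  · intro N
    refine (ae_restrict_iff' measurableSet_Ioi).2 (Eventually.of_forall fun w (hw : 0 < w) => ?_)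
    rw [norm_mul]
    gcongr
    have h := pow_le_one₀ (n := N) (abs_nonneg _) (habs w hw).le
    calc ‖1 - (c * Real.exp (-w)) ^ N‖ ≤ ‖(1 : ℝ)‖ + ‖(c * Real.exp (-w)) ^ N‖ := norm_sub_le _ _
      _ ≤ 2 := by rw [norm_pow, norm_one, Real.norm_eq_abs]; linarith
  · refine (ae_restrict_iff' measurableSet_Ioi).2 (Eventually.of_forall fun w (hw : 0 < w) => ?_)
    have h := tendsto_pow_atTop_nhds_zero_of_abs_lt_one (habs w hw)
    simpa using (h.const_sub 1).const_mul (F w / (1 - c * Real.exp (-w)))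

theorem pow_mul_exp_mul_geom_term (c α w : ℝ) (k m : ℕ) :
    w ^ k * Real.exp (-(α * w)) * (c * Real.exp (-w)) ^ m =
      c ^ m * (w ^ k * Real.exp (-(((m : ℝ) + α) * w))) := by
  rw [mul_pow, ← Real.exp_nat_mul,
    show -(((m : ℝ) + α) * w) = -(α * w) + (m : ℝ) * -w by ring, Real.exp_add]
  ring

theorem lerchPhi_eq_integral {c : ℝ} (hc : c = 1 ∨ c = -1) {k : ℕ} (hk : 1 ≤ k)
    (h : ¬ (c = 1 ∧ k = 1)) {α : ℝ} (hα : 0 < α) :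
    ∫ w in Set.Ioi (0 : ℝ), w ^ (k - 1) * Real.exp (-(α * w)) / (1 - c * Real.exp (-w)) =
      (Nat.factorial (k - 1) : ℝ) * lerchPhi c k α := by
  have hT := tendsto_integral_mul_geom_sum hc (integrableOn_lerch_integrand hc hk h hα)
  have key : ∀ N : ℕ, ∫ w in Set.Ioi (0 : ℝ), w ^ (k - 1) * Real.exp (-(α * w)) *
      ∑ m ∈ Finset.range N, (c * Real.exp (-w)) ^ m =
      (Nat.factorial (k - 1) : ℝ) * ∑ m ∈ Finset.range N, c ^ m / ((m : ℝ) + α) ^ k := by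
    intro N
    simp_rw [Finset.mul_sum, pow_mul_exp_mul_geom_term]
    rw [integral_finsetSum]
    · refine Finset.sum_congr rfl fun m _ => ?_
      rw [integral_const_mul, integral_pow_mul_exp_neg _ (by positivity), Nat.sub_add_cancel hk]
      ring
    · intro m _
      exact (integrableOn_pow_mul_exp_neg _ (by positivity)).const_mul _
  simp_rw [key] at hT
  have hne : (Nat.factorial (k - 1) : ℝ) ≠ 0 := by positivity
  have hT2 := hT.const_mul (Nat.factorial (k - 1) : ℝ)⁻¹
  simp_rw [inv_mul_cancel_left₀ hne] at hT2
  rw [lerchPhi, hT2.limUnder_eq, mul_inv_cancel_left₀ hne]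

theorem abs_exp_neg_sub_exp_neg_le {x y μ : ℝ} (hx : μ ≤ x) (hy : μ ≤ y) :
    |Real.exp (-x) - Real.exp (-y)| ≤ |x - y| * Real.exp (-μ) := by
  wlog hxy : x ≤ y generalizing x y
  · rw [abs_sub_comm, abs_sub_comm x y]
    exact this hy hx (le_of_not_ge hxy)
  have h1 : Real.exp (-y) ≤ Real.exp (-x) := Real.exp_le_exp.2 (by linarith)
  rw [abs_of_nonneg (by linarith), abs_of_nonpos (by linarith)]
  have h2 := Real.add_one_le_exp (x - y)
  have h3 : Real.exp (-y) = Real.exp (-x) * Real.exp (x - y) := by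
    rw [← Real.exp_add]; congr 1; ring
  have h4 : Real.exp (-x) ≤ Real.exp (-μ) := Real.exp_le_exp.2 (by linarith)
  have h5 := Real.exp_pos (-x)
  rw [h3]
  nlinarith

theorem integrableOn_cot_integrand {α : ℝ} (h0 : 0 < α) (h1 : α < 1) :
    IntegrableOn (fun w : ℝ => (Real.exp (-(α * w)) - Real.exp (-((1 - α) * w))) /
      (1 - 1 * Real.exp (-w))) (Set.Ioi 0) := by
  set μ := min α (1 - α) with hμ
  have hμ0 : 0 < μ := lt_min h0 (by linarith)
  refine Integrable.mono' ((integrableOn_pow_mul_exp_neg 1 hμ0).add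
      (integrableOn_pow_mul_exp_neg 0 hμ0)) ?_ ?_
  · apply Measurable.aestronglyMeasurable; fun_prop
  refine (ae_restrict_iff' measurableSet_Ioi).2 (Eventually.of_forall fun w (hw : 0 < w) => ?_)
  have h1 := inv_one_sub_sign_mul_exp_neg_le (Or.inl rfl : (1 : ℝ) = 1 ∨ (1 : ℝ) = -1) hw
  have h0 := one_sub_sign_mul_exp_neg_pos (Or.inl rfl : (1 : ℝ) = 1 ∨ (1 : ℝ) = -1) hw
  have h2 := abs_exp_neg_sub_exp_neg_le (x := α * w) (y := (1 - α) * w) (μ := μ * w)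
    (by gcongr; exact min_le_left _ _) (by gcongr; exact min_le_right _ _)
  have h3 : |α * w - (1 - α) * w| ≤ w := by
    rw [abs_le]; constructor <;> nlinarith
  rw [div_eq_mul_inv, norm_mul, Real.norm_eq_abs, Real.norm_of_nonneg (inv_nonneg.2 h0.le)]
  calc _ ≤ (w * Real.exp (-(μ * w))) * (1 + w⁻¹) := by
        gcongr; exact h2.trans (by gcongr)
    _ = _ := by simp only [Pi.add_apply, pow_one, pow_zero]; field_simp

theorem tendsto_cot_partial_sums {α : ℝ} (h0 : 0 < α) (h1 : α < 1) :
    Tendsto (fun N : ℕ => ∑ m ∈ Finset.range N, (1 / ((m : ℝ) + α) - 1 / ((m : ℝ) + (1 - α))))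
      atTop (𝓝 (Real.pi * Real.cot (Real.pi * α))) := by
  have hx : (α : ℂ) ∈ Complex.integerComplement := by
    rintro ⟨j, hj⟩
    have hj' : (j : ℝ) = α := by exact_mod_cast hj
    have h2 : (0 : ℤ) < j := by exact_mod_cast hj' ▸ h0
    have h3 : j < 1 := by exact_mod_cast hj' ▸ h1
    omega
  have hre := (Complex.continuous_re.tendsto _).comp (tendsto_logDeriv_euler_cot_sub hx)
  have e1 : ((Real.pi : ℂ) * Complex.cot (Real.pi * α) - 1 / (α : ℂ)).re =
      Real.pi * Real.cot (Real.pi * α) - 1 / α := by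
    rw [← Complex.ofReal_re (Real.pi * Real.cot (Real.pi * α) - 1 / α)]
    push_cast; rfl
  rw [e1] at hre
  have hN : Tendsto (fun N : ℕ => 1 / ((N : ℝ) + α)) atTop (𝓝 0) := by
    simp_rw [one_div]
    exact tendsto_inv_atTop_zero.comp
      (tendsto_atTop_add_const_right _ _ tendsto_natCast_atTop_atTop)
  have h := (hre.const_add (1 / α)).sub hN
  rw [sub_zero, add_sub_cancel] at h
  refine h.congr fun N => ?_
  induction N with
  | zero => simp
  | succ N ih =>
    rw [Finset.sum_range_succ, ← ih]
    have e2 : (cotTerm (α : ℂ) N).re = 1 / (α - (N + 1)) + 1 / (α + (N + 1)) := by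
      rw [← Complex.ofReal_re (1 / (α - (N + 1)) + 1 / (α + (N + 1)))]
      push_cast; rfl
    have e3 : (N : ℝ) + (1 - α) = -(α - (N + 1)) := by ring
    simp only [Function.comp_apply, Finset.sum_range_succ, Complex.add_re, e2, e3, one_div,
      inv_neg]
    push_cast
    ring

theorem integral_cot_integrand {α : ℝ} (h0 : 0 < α) (h1 : α < 1) :
    ∫ w in Set.Ioi (0 : ℝ), (Real.exp (-(α * w)) - Real.exp (-((1 - α) * w))) /
      (1 - 1 * Real.exp (-w)) = Real.pi * Real.cot (Real.pi * α) := by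
  have hT := tendsto_integral_mul_geom_sum (Or.inl rfl) (integrableOn_cot_integrand h0 h1)
  refine tendsto_nhds_unique hT ((tendsto_cot_partial_sums h0 h1).congr fun N => ?_)
  simp_rw [Finset.mul_sum]
  have hterm : ∀ (w : ℝ) (m : ℕ), (Real.exp (-(α * w)) - Real.exp (-((1 - α) * w))) *
      (1 * Real.exp (-w)) ^ m = w ^ 0 * Real.exp (-(((m : ℝ) + α) * w)) -
        w ^ 0 * Real.exp (-(((m : ℝ) + (1 - α)) * w)) := by
    intro w m
    have e1 := pow_mul_exp_mul_geom_term 1 α w 0 m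
    have e2 := pow_mul_exp_mul_geom_term 1 (1 - α) w 0 m
    simp only [one_pow, one_mul] at e1 e2 ⊢
    rw [← e1, ← e2]; ring
  simp_rw [hterm]
  have hi1 : ∀ m : ℕ, 0 < (m : ℝ) + α := fun m => by positivity
  have hi2 : ∀ m : ℕ, 0 < (m : ℝ) + (1 - α) := fun m =>
    add_pos_of_nonneg_of_pos (Nat.cast_nonneg m) (by linarith)
  rw [integral_finsetSum]
  · refine Finset.sum_congr rfl fun m _ => ?_
    rw [integral_sub (integrableOn_pow_mul_exp_neg 0 (hi1 m))
      (integrableOn_pow_mul_exp_neg 0 (hi2 m)), integral_pow_mul_exp_neg 0 (hi1 m),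
      integral_pow_mul_exp_neg 0 (hi2 m)]
    simp
  · intro m _
    exact (integrableOn_pow_mul_exp_neg 0 (hi1 m)).sub (integrableOn_pow_mul_exp_neg 0 (hi2 m))

theorem exp_mul_div_one_sub_sign_mul_exp {b : ℝ} (hb : b = 1 ∨ b = -1) (α w : ℝ) :
    Real.exp (α * w) / (1 - b * Real.exp w) =
      -b * (Real.exp (-((1 - α) * w)) / (1 - b * Real.exp (-w))) := by
  have hb2 : b * b = 1 := by rcases hb with rfl | rfl <;> norm_num
  have e : 1 - b * Real.exp w = -b * Real.exp w * (1 - b * Real.exp (-w)) := by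
    have h : Real.exp w * Real.exp (-w) = 1 := by rw [← Real.exp_add]; simp
    linear_combination -(b * b) * h - hb2
  have e2 : Real.exp (α * w) = Real.exp (-((1 - α) * w)) * Real.exp w := by
    rw [← Real.exp_add]; congr 1; ring
  have hbi : (-b)⁻¹ = -b := by rcases hb with rfl | rfl <;> norm_num
  have hw := (Real.exp_pos w).ne'
  rw [e, e2, div_eq_mul_inv, mul_inv, mul_inv, hbi]
  field_simp

/-- The principal value of `∫ w ^ (k - 1) e ^ (α w) / (1 - b e ^ w)` over the real line, where
`α = s / r`, folded at the possible pole `w = 0`, is a multiple of `Θ`. -/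
theorem integral_theta_integrand {b : ℝ} (hb : b = 1 ∨ b = -1) {k : ℕ} (hk : 1 ≤ k)
    {s r : ℝ} (hr : 0 < r) (hs : 0 < s) (hsr : s < r) :
    IntegrableOn (fun w : ℝ => w ^ (k - 1) * (Real.exp (s / r * w) / (1 - b * Real.exp w)) +
      (-w) ^ (k - 1) * (Real.exp (-(s / r * w)) / (1 - b * Real.exp (-w)))) (Set.Ioi 0) ∧
    ∫ w in Set.Ioi (0 : ℝ), (w ^ (k - 1) * (Real.exp (s / r * w) / (1 - b * Real.exp w)) +
      (-w) ^ (k - 1) * (Real.exp (-(s / r * w)) / (1 - b * Real.exp (-w)))) =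
      (-1) ^ (k - 1) * (Nat.factorial (k - 1) : ℝ) * lerchTheta b k s r := by
  have hα0 : 0 < s / r := by positivity
  have hα1 : s / r < 1 := (div_lt_one hr).2 hsr
  have hα2 : (r - s) / r = 1 - s / r := by field_simp
  simp_rw [exp_mul_div_one_sub_sign_mul_exp hb]
  by_cases h : b = 1 ∧ k = 1
  · obtain ⟨rfl, rfl⟩ := h
    have e : (fun w : ℝ => w ^ (1 - 1) * (-1 * (Real.exp (-((1 - s / r) * w)) /
        (1 - 1 * Real.exp (-w)))) + (-w) ^ (1 - 1) * (Real.exp (-(s / r * w)) /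
        (1 - 1 * Real.exp (-w)))) = fun w => (Real.exp (-(s / r * w)) -
          Real.exp (-((1 - s / r) * w))) / (1 - 1 * Real.exp (-w)) := by
      ext w; simp only [Nat.sub_self, pow_zero]; ring
    rw [e, integral_cot_integrand hα0 hα1]
    refine ⟨integrableOn_cot_integrand hα0 hα1, ?_⟩
    simp [lerchTheta, mul_div_assoc]
  · have i1 := integrableOn_lerch_integrand hb hk h hα0
    have i2 := integrableOn_lerch_integrand hb hk h (sub_pos.2 hα1)
    have e : (fun w : ℝ => w ^ (k - 1) * (-b * (Real.exp (-((1 - s / r) * w)) /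
        (1 - b * Real.exp (-w)))) + (-w) ^ (k - 1) * (Real.exp (-(s / r * w)) /
        (1 - b * Real.exp (-w)))) = fun w =>
        -b * (w ^ (k - 1) * Real.exp (-((1 - s / r) * w)) / (1 - b * Real.exp (-w))) +
        (-1) ^ (k - 1) * (w ^ (k - 1) * Real.exp (-(s / r * w)) / (1 - b * Real.exp (-w))) := by
      ext w; rw [neg_pow w]; ring
    rw [e]
    refine ⟨(i2.const_mul _).add (i1.const_mul _), ?_⟩
    rw [integral_add (i2.const_mul _) (i1.const_mul _), integral_const_mul, integral_const_mul,
      lerchPhi_eq_integral hb hk h hα0, lerchPhi_eq_integral hb hk h (sub_pos.2 hα1), lerchTheta,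
      if_neg h, hα2]
    obtain ⟨j, rfl⟩ : ∃ j, k = j + 1 := ⟨k - 1, by omega⟩
    have hsq : ((-1 : ℝ) ^ j) * (-1) ^ j = 1 := by rw [← mul_pow]; norm_num
    simp only [Nat.add_sub_cancel, pow_succ]
    linear_combination (b * (j.factorial : ℝ) * lerchPhi b (j + 1) (1 - s / r)) * hsq

/-! ### The polylogarithm in logarithmic coordinates -/

/-- The kernel `z y / (1 - z y)` with `z y = b e ^ w`, up to the factor `b`. -/
noncomputable def logKernel (b w : ℝ) : ℝ := 1 / (Real.exp (-w) - b)

/-- The truncated power `τ ^ (p - 1)` on `(0, ∞)`, extended by `0`. -/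
noncomputable def truncPow (p : ℕ) (τ : ℝ) : ℝ := if 0 < τ then τ ^ (p - 1) else 0

/-- The integrand of `∫ truncPow p τ * logKernel b (σ - τ) dτ`, folded at the possible pole
`τ = σ`. For `b = 1` the two poles cancel, and the integral over `w > 0` is absolutely convergent
and equals the principal value. -/
noncomputable def foldedPow (b : ℝ) (p : ℕ) (σ w : ℝ) : ℝ :=
  truncPow p (σ - w) * logKernel b w + truncPow p (σ + w) * logKernel b (-w)

@[fun_prop]
theorem measurable_logKernel (b : ℝ) : Measurable (logKernel b) := by
  unfold logKernel; fun_prop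

@[fun_prop]
theorem measurable_truncPow (p : ℕ) : Measurable (truncPow p) :=
  Measurable.ite measurableSet_Ioi (by fun_prop) measurable_const

theorem truncPow_nonneg (p : ℕ) (τ : ℝ) : 0 ≤ truncPow p τ := by
  unfold truncPow; split_ifs <;> positivity

theorem truncPow_of_pos {p : ℕ} {τ : ℝ} (h : 0 < τ) : truncPow p τ = τ ^ (p - 1) := if_pos h

theorem truncPow_of_nonpos {p : ℕ} {τ : ℝ} (h : τ ≤ 0) : truncPow p τ = 0 := if_neg (not_lt.2 h)

theorem exp_sub_sign_pos {b w : ℝ} (hb : b = 1 ∨ b = -1) (hw : 0 < w) : 0 < Real.exp w - b := by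
  have h1 : 1 < Real.exp w := Real.one_lt_exp_iff.2 hw
  rcases hb with rfl | rfl <;> linarith

theorem logKernel_neg_eq {b : ℝ} (w : ℝ) :
    logKernel b (-w) = Real.exp (-w) / (1 - b * Real.exp (-w)) := by
  have h : Real.exp w * Real.exp (-w) = 1 := by rw [← Real.exp_add]; simp
  have e : 1 - b * Real.exp (-w) = Real.exp (-w) * (Real.exp w - b) := by linear_combination -h
  rw [logKernel, neg_neg, e, div_mul_cancel_left₀ (Real.exp_pos _).ne', one_div]

theorem logKernel_neg_nonneg {b w : ℝ} (hb : b = 1 ∨ b = -1) (hw : 0 < w) :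
    0 ≤ logKernel b (-w) := by
  have := exp_sub_sign_pos hb hw
  rw [logKernel, neg_neg]; positivity

theorem logKernel_neg_le {b w : ℝ} (hb : b = 1 ∨ b = -1) (hw : 0 < w) :
    logKernel b (-w) ≤ Real.exp (-w) * (1 + w⁻¹) := by
  rw [logKernel_neg_eq, div_eq_mul_inv]
  gcongr
  exact inv_one_sub_sign_mul_exp_neg_le hb hw

theorem logKernel_eq {b w : ℝ} (hb : b = 1 ∨ b = -1) (hw : 0 < w) :
    logKernel b w = -b - logKernel b (-w) := by
  have h1 : Real.exp w * Real.exp (-w) = 1 := by rw [← Real.exp_add]; simp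
  have h2 := (exp_sub_sign_pos hb hw).ne'
  have h3 := one_sub_sign_mul_exp_neg_pos hb hw
  have h4 : Real.exp (-w) - b ≠ 0 := by
    rcases hb with rfl | rfl
    · linarith
    · have := Real.exp_pos (-w); linarith
  rw [logKernel, logKernel, neg_neg]
  field_simp
  rcases hb with rfl | rfl
  · linear_combination h1
  · linear_combination -h1

theorem foldedPow_eq {b : ℝ} (hb : b = 1 ∨ b = -1) (p : ℕ) (σ : ℝ) {w : ℝ} (hw : 0 < w) :
    foldedPow b p σ w = -b * truncPow p (σ - w) +
      logKernel b (-w) * (truncPow p (σ + w) - truncPow p (σ - w)) := by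
  rw [foldedPow, logKernel_eq hb hw]; ring

theorem truncPow_sub_le (p : ℕ) {c : ℝ} (hc : 0 ≤ c) (σ : ℝ) {w : ℝ} (hw : 0 < w) :
    truncPow p (σ - w) ≤ |σ| ^ (p - 1) * Real.exp (c * |σ|) * Real.exp (-(c * w)) := by
  by_cases h : 0 < σ - w
  · rw [truncPow_of_pos h, mul_assoc, ← Real.exp_add]
    have h1 : |σ| = σ := abs_of_pos (by linarith)
    rw [h1]
    have h2 : (σ - w) ^ (p - 1) ≤ σ ^ (p - 1) := by gcongr; linarith
    have h3 : 1 ≤ Real.exp (c * σ + -(c * w)) := Real.one_le_exp (by nlinarith)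
    have h4 : 0 ≤ σ ^ (p - 1) := pow_nonneg (by linarith) _
    nlinarith
  · rw [truncPow_of_nonpos (not_lt.1 h)]; positivity

/-- The second term handles `w < |σ|`, where both points lie on the same side of the jump at `0`;
in the first, `(w / |σ|) ^ (1/2)` majorizes the indicator of `|σ| ≤ w`, so that each term is a
product of a function of `w` and a function of `σ`. -/
theorem abs_truncPow_add_sub_truncPow_sub_le (p : ℕ) {σ : ℝ} (hσ : σ ≠ 0) {w : ℝ} (hw : 0 < w) :
    |truncPow p (σ + w) - truncPow p (σ - w)| ≤
      |σ| ^ (-(1 / 2) : ℝ) * (w ^ (1 / 2 : ℝ) * (2 * w) ^ (p - 1)) +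
        2 * ((p - 1 : ℕ) : ℝ) * (2 * |σ|) ^ (p - 1 - 1) * w := by
  have hσ' : 0 < |σ| := abs_pos.2 hσ
  have t1 : 0 ≤ |σ| ^ (-(1 / 2) : ℝ) * (w ^ (1 / 2 : ℝ) * (2 * w) ^ (p - 1)) := by positivity
  have t2 : 0 ≤ 2 * ((p - 1 : ℕ) : ℝ) * (2 * |σ|) ^ (p - 1 - 1) * w := by positivity
  rcases le_or_gt |σ| w with h | h
  · have h1 := abs_le.1 h
    rw [truncPow_of_nonpos (by linarith : σ - w ≤ 0), sub_zero,
      abs_of_nonneg (truncPow_nonneg _ _)]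
    have h2 : truncPow p (σ + w) ≤ (2 * w) ^ (p - 1) := by
      unfold truncPow
      split_ifs with h3
      · gcongr; linarith
      · positivity
    have h3 : 1 ≤ |σ| ^ (-(1 / 2) : ℝ) * w ^ (1 / 2 : ℝ) := by
      rw [Real.rpow_neg hσ'.le, inv_mul_eq_div, one_le_div (by positivity)]
      gcongr
    have h4 : 0 ≤ (2 * w) ^ (p - 1) := by positivity
    nlinarith
  · rcases lt_or_gt_of_ne hσ with hn | hpos
    · rw [abs_of_neg hn] at h
      rw [truncPow_of_nonpos (by linarith), truncPow_of_nonpos (by linarith)]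
      simpa using add_nonneg t1 t2
    · rw [abs_of_pos hpos] at h
      rw [truncPow_of_pos (by linarith), truncPow_of_pos (by linarith)]
      have h1 : |(σ + w) ^ (p - 1) - (σ - w) ^ (p - 1)| ≤
          |(σ + w) - (σ - w)| * ((p - 1 : ℕ) : ℝ) * max |σ + w| |σ - w| ^ (p - 1 - 1) :=
        abs_pow_sub_pow_le _ _ _
      refine h1.trans (le_trans ?_ (le_add_of_nonneg_left t1))
      have h2 : max |σ + w| |σ - w| ≤ 2 * |σ| := by
        rw [abs_of_pos hpos, abs_of_pos (by linarith : 0 < σ + w),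
          abs_of_pos (by linarith : 0 < σ - w)]
        exact max_le (by linarith) (by linarith)
      have h3 : |(σ + w) - (σ - w)| = 2 * w := by
        rw [show (σ + w) - (σ - w) = 2 * w by ring, abs_of_pos (by linarith)]
      rw [h3]
      calc 2 * w * ((p - 1 : ℕ) : ℝ) * max |σ + w| |σ - w| ^ (p - 1 - 1)
          ≤ 2 * w * ((p - 1 : ℕ) : ℝ) * (2 * |σ|) ^ (p - 1 - 1) := by gcongr
        _ = _ := by ring

theorem integrableOn_rpow_mul_exp_neg {s c : ℝ} (hs : -1 < s) (hc : 0 < c) :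
    IntegrableOn (fun w : ℝ => w ^ s * Real.exp (-(c * w))) (Set.Ioi 0) := by
  have h := integrableOn_rpow_mul_exp_neg_mul_rpow (p := 1) hs one_pos hc
  refine h.congr_fun (fun w _ => ?_) measurableSet_Ioi
  simp

theorem integrableOn_jump_weight (p : ℕ) :
    IntegrableOn (fun w : ℝ => Real.exp (-w) * (1 + w⁻¹) *
      (w ^ (1 / 2 : ℝ) * (2 * w) ^ (p - 1))) (Set.Ioi 0) := by
  have hp : (0 : ℝ) ≤ ((p - 1 : ℕ) : ℝ) := Nat.cast_nonneg _
  have h1 := integrableOn_rpow_mul_exp_neg (s := ((p - 1 : ℕ) : ℝ) + 1 / 2) (by linarith) one_pos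
  have h2 := integrableOn_rpow_mul_exp_neg (s := ((p - 1 : ℕ) : ℝ) + 1 / 2 - 1) (by linarith)
    one_pos
  refine IntegrableOn.congr_fun ((h1.add h2).const_mul (2 ^ (p - 1)))
    (fun w (hw : 0 < w) => ?_) measurableSet_Ioi
  simp only [Pi.add_apply]
  rw [Real.rpow_sub hw, Real.rpow_add hw, Real.rpow_natCast, Real.rpow_one, mul_pow]
  field_simp

theorem integrableOn_smooth_weight :
    IntegrableOn (fun w : ℝ => Real.exp (-w) * (1 + w⁻¹) * w) (Set.Ioi 0) := by
  have h1 := integrableOn_pow_mul_exp_neg 1 one_pos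
  have h2 := integrableOn_pow_mul_exp_neg 0 one_pos
  refine (h1.add h2).congr_fun (fun w (hw : 0 < w) => ?_) measurableSet_Ioi
  simp only [Pi.add_apply]
  field_simp

theorem abs_foldedPow_le {b : ℝ} (hb : b = 1 ∨ b = -1) (p : ℕ) {c : ℝ} (hc : 0 ≤ c)
    {σ : ℝ} (hσ : σ ≠ 0) {w : ℝ} (hw : 0 < w) :
    |foldedPow b p σ w| ≤ |σ| ^ (p - 1) * Real.exp (c * |σ|) * Real.exp (-(c * w)) +
      (|σ| ^ (-(1 / 2) : ℝ) * (Real.exp (-w) * (1 + w⁻¹) * (w ^ (1 / 2 : ℝ) * (2 * w) ^ (p - 1))) +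
        2 * ((p - 1 : ℕ) : ℝ) * (2 * |σ|) ^ (p - 1 - 1) * (Real.exp (-w) * (1 + w⁻¹) * w)) := by
  have hb1 : |-b| = 1 := by rcases hb with rfl | rfl <;> simp
  rw [foldedPow_eq hb p σ hw]
  refine (abs_add_le _ _).trans (add_le_add ?_ ?_)
  · rw [abs_mul, hb1, one_mul, abs_of_nonneg (truncPow_nonneg _ _)]
    exact truncPow_sub_le p hc σ hw
  · rw [abs_mul, abs_of_nonneg (logKernel_neg_nonneg hb hw)]
    calc _ ≤ Real.exp (-w) * (1 + w⁻¹) * _ :=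
          mul_le_mul (logKernel_neg_le hb hw) (abs_truncPow_add_sub_truncPow_sub_le p hσ hw)
            (abs_nonneg _) (by positivity)
      _ = _ := by ring

@[fun_prop]
theorem measurable_foldedPow_uncurry (b : ℝ) (p : ℕ) :
    Measurable (fun z : ℝ × ℝ => foldedPow b p z.1 z.2) := by
  unfold foldedPow; fun_prop

theorem measurable_foldedPow (b : ℝ) (p : ℕ) (σ : ℝ) : Measurable (foldedPow b p σ) := by
  unfold foldedPow; fun_prop

theorem integrableOn_foldedPow {b : ℝ} (hb : b = 1 ∨ b = -1) (p : ℕ) {σ : ℝ} (hσ : σ ≠ 0) :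
    IntegrableOn (foldedPow b p σ) (Set.Ioi 0) := by
  have i0 : IntegrableOn (fun w : ℝ => Real.exp (-(1 * w))) (Set.Ioi 0) := by
    simpa using integrableOn_pow_mul_exp_neg 0 one_pos
  refine Integrable.mono' ((i0.const_mul (|σ| ^ (p - 1) * Real.exp (1 * |σ|))).add
    (((integrableOn_jump_weight p).const_mul (|σ| ^ (-(1 / 2) : ℝ))).add
      (integrableOn_smooth_weight.const_mul (2 * ((p - 1 : ℕ) : ℝ) * (2 * |σ|) ^ (p - 1 - 1)))))
    (measurable_foldedPow b p σ).aestronglyMeasurable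
    ((ae_restrict_iff' measurableSet_Ioi).2 (Eventually.of_forall fun w (hw : 0 < w) => ?_))
  exact abs_foldedPow_le hb p zero_le_one hσ hw

theorem integral_Ioo_zero_exp_neg (f : ℝ → ℝ) (A : ℝ) :
    ∫ y in Set.Ioo 0 (Real.exp (-A)), f y =
      ∫ τ in Set.Ioi A, Real.exp (-τ) * f (Real.exp (-τ)) := by
  have him : (fun τ => Real.exp (-τ)) '' Set.Ioi A = Set.Ioo 0 (Real.exp (-A)) := by
    ext y
    constructor
    · rintro ⟨τ, hτ, rfl⟩
      exact ⟨Real.exp_pos _, Real.exp_lt_exp.2 (by simpa using hτ)⟩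
    · rintro ⟨h0, h1⟩
      refine ⟨-Real.log y, ?_, by simp [Real.exp_log h0]⟩
      have := (Real.log_lt_iff_lt_exp h0).2 h1
      simp only [Set.mem_Ioi]; linarith
  rw [← him, integral_image_eq_integral_abs_deriv_smul measurableSet_Ioi
    (f' := fun τ => -Real.exp (-τ))]
  · refine setIntegral_congr_fun measurableSet_Ioi fun τ _ => ?_
    simp [abs_of_pos (Real.exp_pos _)]
  · intro τ _
    simpa using ((hasDerivAt_neg τ).exp).hasDerivWithinAt
  · intro x _ y _ h
    simpa using h

theorem integral_Ioo_exp_neg (f : ℝ → ℝ) (A B : ℝ) :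
    ∫ y in Set.Ioo (Real.exp (-B)) (Real.exp (-A)), f y =
      ∫ τ in Set.Ioo A B, Real.exp (-τ) * f (Real.exp (-τ)) := by
  have him : (fun τ => Real.exp (-τ)) '' Set.Ioo A B =
      Set.Ioo (Real.exp (-B)) (Real.exp (-A)) := by
    ext y
    constructor
    · rintro ⟨τ, hτ, rfl⟩
      exact ⟨Real.exp_lt_exp.2 (by simpa using hτ.2), Real.exp_lt_exp.2 (by simpa using hτ.1)⟩
    · rintro ⟨h0, h1⟩
      have hy : 0 < y := (Real.exp_pos _).trans h0
      refine ⟨-Real.log y, ⟨?_, ?_⟩, by simp [Real.exp_log hy]⟩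
      · have := (Real.log_lt_iff_lt_exp hy).2 h1
        linarith
      · have := (Real.lt_log_iff_exp_lt hy).2 h0
        linarith
  rw [← him, integral_image_eq_integral_abs_deriv_smul measurableSet_Ioo
    (f' := fun τ => -Real.exp (-τ))]
  · refine setIntegral_congr_fun measurableSet_Ioo fun τ _ => ?_
    simp [abs_of_pos (Real.exp_pos _)]
  · intro τ _
    simpa using ((hasDerivAt_neg τ).exp).hasDerivWithinAt
  · intro x _ y _ h
    simpa using h

/-- The integrand of the polylogarithm at `b e ^ σ` in the variable `τ = -log y`. -/
theorem exp_neg_mul_polylog_integrand (b σ : ℝ) (p : ℕ) {τ : ℝ} (hτ : 0 < τ) :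
    Real.exp (-τ) * (b * Real.exp σ * Real.log (Real.exp (-τ)) ^ (p - 1) /
      (1 - b * Real.exp σ * Real.exp (-τ))) =
      b * (-1) ^ (p - 1) * (truncPow p τ * logKernel b (σ - τ)) := by
  have e : 1 - b * Real.exp σ * Real.exp (-τ) =
      Real.exp σ * Real.exp (-τ) * (Real.exp (-(σ - τ)) - b) := by
    have h : Real.exp σ * Real.exp (-τ) * Real.exp (-(σ - τ)) = 1 := by
      rw [← Real.exp_add, ← Real.exp_add, Real.exp_eq_one_iff]; ring
    linear_combination -h
  rw [truncPow_of_pos hτ, Real.log_exp, e, logKernel, neg_pow τ]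
  have h1 := (Real.exp_pos σ).ne'
  have h2 := (Real.exp_pos (-τ)).ne'
  by_cases h3 : Real.exp (-(σ - τ)) - b = 0
  · rw [h3]; simp
  · field_simp

theorem integral_Ioi_truncPow_mul_logKernel_eq {b : ℝ} (p : ℕ) {σ : ℝ}
    (hi : Integrable (fun τ => truncPow p τ * logKernel b (σ - τ))) :
    ∫ τ in Set.Ioi (0 : ℝ), truncPow p τ * logKernel b (σ - τ) =
      ∫ w in Set.Ioi (0 : ℝ), foldedPow b p σ w := by
  set φ : ℝ → ℝ := fun τ => truncPow p τ * logKernel b (σ - τ) with hφ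
  have h1 : ∫ τ in Set.Ioi (0 : ℝ), φ τ = ∫ τ, φ τ := by
    refine setIntegral_eq_integral_of_forall_compl_eq_zero fun τ hτ => ?_
    simp only [Set.mem_Ioi, not_lt] at hτ
    simp [hφ, truncPow_of_nonpos hτ]
  have h2 : ∫ w, φ w = ∫ w, φ (σ + w) := (integral_add_left_eq_self φ σ).symm
  have hi2 : Integrable (fun w => φ (σ + w)) := hi.comp_add_left σ
  rw [h1, h2, ← intervalIntegral.integral_Iic_add_Ioi hi2.integrableOn hi2.integrableOn (b := 0),
    ← neg_zero, ← integral_comp_neg_Ioi, neg_zero, ← integral_add]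
  · refine setIntegral_congr_fun measurableSet_Ioi fun w _ => ?_
    simp [hφ, foldedPow, sub_eq_add_neg]
  · have := hi2.comp_neg
    exact this.integrableOn
  · exact hi2.integrableOn

theorem integrable_truncPow_mul_logKernel {b : ℝ} (hb : b = 1 ∨ b = -1) (p : ℕ) {σ : ℝ}
    (h : b = -1 ∨ σ < 0) :
    Integrable (fun τ => truncPow p τ * logKernel b (σ - τ)) := by
  obtain ⟨K, hK⟩ : ∃ K : ℝ, ∀ τ, 0 < τ →
      |logKernel b (σ - τ)| ≤ K * Real.exp (-τ) := by
    by_cases h2 : b = -1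
    · refine ⟨Real.exp σ, fun τ _ => ?_⟩
      have h3 := Real.exp_pos (-(σ - τ))
      rw [logKernel, h2, sub_neg_eq_add, abs_of_pos (by positivity), ← Real.exp_add,
        show σ + -τ = -(-(σ - τ)) by ring, Real.exp_neg (-(σ - τ)), one_div]
      exact inv_anti₀ h3 (by linarith)
    · have hσ : σ < 0 := h.resolve_left h2
      have hσ' : 0 < -σ := by linarith
      refine ⟨1 + (-σ)⁻¹, fun τ hτ => ?_⟩
      have h3 : 0 < τ - σ := by linarith
      rw [show σ - τ = -(τ - σ) by ring, abs_of_nonneg (logKernel_neg_nonneg hb h3)]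
      refine (logKernel_neg_le hb h3).trans ?_
      rw [mul_comm]
      gcongr
      · linarith
      · linarith
  have h0 : Integrable ((Set.Ioi (0:ℝ)).indicator
      (fun τ : ℝ => K * (τ ^ (p - 1) * Real.exp (-(1 * τ))))) :=
    (integrable_indicator_iff measurableSet_Ioi).2
      ((integrableOn_pow_mul_exp_neg (p - 1) one_pos).const_mul K)
  refine Integrable.mono' h0 (Measurable.aestronglyMeasurable (by fun_prop))
    (Eventually.of_forall fun τ => ?_)
  by_cases hτ : 0 < τ
  · rw [Set.indicator_of_mem (Set.mem_Ioi.2 hτ), truncPow_of_pos hτ, norm_mul, Real.norm_eq_abs,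
      Real.norm_eq_abs, abs_of_pos (pow_pos hτ _), one_mul]
    have := mul_le_mul_of_nonneg_left (hK τ hτ) (pow_pos hτ (p - 1)).le
    linarith
  · rw [truncPow_of_nonpos (not_lt.1 hτ), Set.indicator_of_notMem (by simpa using hτ)]
    simp

theorem abs_truncPow_sub_mul_logKernel_le {b : ℝ} (hb : b = 1 ∨ b = -1) (p : ℕ) {σ : ℝ} (hσ : 0 < σ)
    {w : ℝ} (hw : 0 < w) :
    |truncPow p (σ - w) * logKernel b w| ≤ σ ^ (p - 1) * (2 + w⁻¹) := by
  have h1 : truncPow p (σ - w) ≤ σ ^ (p - 1) := by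
    simpa [abs_of_pos hσ] using truncPow_sub_le p le_rfl σ hw
  have h2 := logKernel_neg_le hb hw
  have h3 := logKernel_neg_nonneg hb hw
  have h4 : Real.exp (-w) ≤ 1 := Real.exp_le_one_iff.2 (by linarith)
  have h5 : 0 < w⁻¹ := inv_pos.2 hw
  have h6 : |logKernel b w| ≤ 2 + w⁻¹ := by
    have h7 : logKernel b (-w) ≤ 1 + w⁻¹ := h2.trans (by nlinarith)
    rw [logKernel_eq hb hw, abs_le]
    rcases hb with rfl | rfl <;> constructor <;> linarith
  rw [abs_mul, abs_of_nonneg (truncPow_nonneg _ _)]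
  exact mul_le_mul h1 h6 (abs_nonneg _) (by positivity)

theorem integrableOn_truncPow_sub_mul_logKernel {b : ℝ} (hb : b = 1 ∨ b = -1) (p : ℕ)
    {σ : ℝ} (hσ : 0 < σ) {δ : ℝ} (hδ : 0 < δ) :
    IntegrableOn (fun w => truncPow p (σ - w) * logKernel b w) (Set.Ioi δ) := by
  have hfin : IntegrableOn (fun w => truncPow p (σ - w) * logKernel b w) (Set.Ioc δ (max δ σ)) := by
    refine IntegrableOn.of_bound (by simp) (Measurable.aestronglyMeasurable (by fun_prop))
      (σ ^ (p - 1) * (2 + δ⁻¹))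
      ((ae_restrict_iff' measurableSet_Ioc).2 (Eventually.of_forall fun w hw => ?_))
    refine (abs_truncPow_sub_mul_logKernel_le hb p hσ (hδ.trans hw.1)).trans ?_
    have := hw.1.le
    gcongr
  have hz : IntegrableOn (fun w => truncPow p (σ - w) * logKernel b w) (Set.Ioi (max δ σ)) := by
    refine integrableOn_zero.congr_fun (fun w hw => ?_) measurableSet_Ioi
    have : σ < w := lt_of_le_of_lt (le_max_right _ _) hw
    rw [truncPow_of_nonpos (by linarith), zero_mul]
  rw [← Set.Ioc_union_Ioi_eq_Ioi (le_max_left δ σ)]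
  exact hfin.union hz

/-- Cutting the two sides of the pole `τ = σ` at different distances `δ₁`, `δ₂` changes the
truncated integral only by an integral over the short interval between `δ₂` and `δ₁`. -/
theorem truncated_integrals_eq {b : ℝ} (hb : b = 1 ∨ b = -1) (p : ℕ) {σ : ℝ} (hσ : 0 < σ)
    {δ₁ δ₂ : ℝ} (h2 : 0 < δ₂) (h21 : δ₂ ≤ δ₁) :
    (∫ τ in Set.Ioi (σ + δ₁), truncPow p τ * logKernel b (σ - τ)) +
      ∫ τ in Set.Ioo 0 (σ - δ₂), truncPow p τ * logKernel b (σ - τ) =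
    (∫ w in Set.Ioi δ₁, foldedPow b p σ w) +
      ∫ w in Set.Ioc δ₂ δ₁, truncPow p (σ - w) * logKernel b w := by
  set φ : ℝ → ℝ := fun τ => truncPow p τ * logKernel b (σ - τ) with hφ
  have e1 : ∫ τ in Set.Ioi (σ + δ₁), φ τ =
      ∫ w in Set.Ioi δ₁, truncPow p (σ + w) * logKernel b (-w) := by
    rw [← (measurePreserving_add_left volume σ).setIntegral_preimage_emb
      (measurableEmbedding_addLeft σ)]
    simp [hφ]
  have e2 : ∫ τ in Set.Ioo 0 (σ - δ₂), φ τ =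
      ∫ w in Set.Ioi δ₂, truncPow p (σ - w) * logKernel b w := by
    have : ∫ τ in Set.Ioo 0 (σ - δ₂), φ τ = ∫ τ in Set.Iio (σ - δ₂), φ τ := by
      refine (setIntegral_eq_of_subset_of_forall_sdiff_eq_zero measurableSet_Iio
        (fun x hx => hx.2) fun x hx => ?_).symm
      have hx0 : x ≤ 0 := by
        by_contra h
        exact hx.2 ⟨not_le.1 h, hx.1⟩
      simp [hφ, truncPow_of_nonpos hx0]
    rw [this, ← (Measure.measurePreserving_sub_left volume σ).setIntegral_preimage_emb
      (measurableEmbedding_subLeft σ)]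
    simp [hφ]
  have i2 := integrableOn_truncPow_sub_mul_logKernel hb p hσ h2
  have i1 : IntegrableOn (fun w => truncPow p (σ - w) * logKernel b w) (Set.Ioi δ₁) :=
    i2.mono_set (Set.Ioi_subset_Ioi h21)
  have iF : IntegrableOn (foldedPow b p σ) (Set.Ioi δ₁) :=
    (integrableOn_foldedPow hb p hσ.ne').mono_set (Set.Ioi_subset_Ioi (h2.le.trans h21))
  have i3 : IntegrableOn (fun w => truncPow p (σ + w) * logKernel b (-w)) (Set.Ioi δ₁) := by
    refine IntegrableOn.congr_fun (iF.sub i1) (fun w _ => ?_) measurableSet_Ioi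
    simp [foldedPow]
  rw [e1, e2, ← Set.Ioc_union_Ioi_eq_Ioi h21, setIntegral_union Set.Ioc_disjoint_Ioi_same
    measurableSet_Ioi (i2.mono_set (fun x hx => hx.1)) i1]
  have : ∫ w in Set.Ioi δ₁, foldedPow b p σ w =
      (∫ w in Set.Ioi δ₁, truncPow p (σ - w) * logKernel b w) +
        ∫ w in Set.Ioi δ₁, truncPow p (σ + w) * logKernel b (-w) := integral_add i1 i3
  rw [this]; ring

/-- In logarithmic coordinates, the interval `(y₀ - ε, y₀ + ε)` around `y₀ = e ^ (-σ)`, with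
`s = ε / y₀`, becomes `(σ - log (1 + s), σ - log (1 - s))`, symmetric about `σ` to second order. -/
theorem log_asymmetry_bounds {s : ℝ} (h0 : 0 < s) (h1 : s ≤ 1 / 2) :
    0 < Real.log (1 + s) ∧ Real.log (1 + s) ≤ -Real.log (1 - s) ∧ -Real.log (1 - s) ≤ 2 * s ∧
      (2 + (Real.log (1 + s))⁻¹) * (-Real.log (1 - s) - Real.log (1 + s)) ≤ 16 * s := by
  have a1 := Real.one_sub_inv_le_log_of_pos (by linarith : 0 < 1 + s)
  have a2 := Real.one_sub_inv_le_log_of_pos (by linarith : 0 < 1 - s)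
  have a3 := Real.log_le_sub_one_of_pos (by linarith : 0 < 1 + s)
  have a4 := Real.log_le_sub_one_of_pos (by linarith : 0 < 1 - s)
  have b1 : s / 2 ≤ 1 - (1 + s)⁻¹ := by
    have : 1 - (1 + s)⁻¹ = s / (1 + s) := by field_simp; ring
    rw [this]; gcongr; linarith
  have b2 : (1 - s)⁻¹ - 1 ≤ 2 * s := by
    have h : (1 - s) ≠ 0 := by linarith
    have : (1 - s)⁻¹ - 1 = s / (1 - s) := by field_simp; ring
    rw [this, div_le_iff₀ (by linarith)]; nlinarith
  have b3 : (1 - s)⁻¹ - 1 - (1 - (1 + s)⁻¹) ≤ 4 * s ^ 2 := by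
    have h : (1 - s) ≠ 0 := by linarith
    have : (1 - s)⁻¹ - 1 - (1 - (1 + s)⁻¹) = 2 * s ^ 2 / ((1 - s) * (1 + s)) := by
      field_simp; ring
    rw [this, div_le_iff₀ (by nlinarith)]
    have h2 : 1 / 2 ≤ (1 - s) * (1 + s) := by nlinarith
    nlinarith [sq_nonneg s]
  have hl : 0 < Real.log (1 + s) := by linarith
  refine ⟨hl, by linarith, by linarith, ?_⟩
  have c1 : (Real.log (1 + s))⁻¹ ≤ (s / 2)⁻¹ := inv_anti₀ (by linarith) (by linarith)
  calc (2 + (Real.log (1 + s))⁻¹) * (-Real.log (1 - s) - Real.log (1 + s))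
      ≤ (2 + (s / 2)⁻¹) * (4 * s ^ 2) := by
        gcongr
        · linarith
        · linarith
    _ = 8 * s ^ 2 + 8 * s := by field_simp; ring
    _ ≤ 16 * s := by nlinarith

theorem intervalIntegral_eq_Ioo {f : ℝ → ℝ} {u v : ℝ} (h : u ≤ v) :
    ∫ y in u..v, f y = ∫ y in Set.Ioo u v, f y := by
  rw [intervalIntegral.integral_of_le h, integral_Ioc_eq_integral_Ioo]

/-- The principal value defining `Li_p (e ^ σ)` for `σ > 0`, in folded form. -/
theorem cauchyPV_polylog_integrand (p : ℕ) {σ : ℝ} (hσ : 0 < σ) :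
    cauchyPV (fun y => Real.exp σ * Real.log y ^ (p - 1) / (1 - Real.exp σ * y)) 0
      (1 / Real.exp σ) 1 =
      (-1) ^ (p - 1) * ∫ w in Set.Ioi (0 : ℝ), foldedPow 1 p σ w := by
  set f : ℝ → ℝ := fun y => Real.exp σ * Real.log y ^ (p - 1) / (1 - Real.exp σ * y) with hf
  have hb : (1 : ℝ) = 1 ∨ (1 : ℝ) = -1 := Or.inl rfl
  have hy0 : 1 / Real.exp σ = Real.exp (-σ) := by rw [Real.exp_neg, one_div]
  have hpos := Real.exp_pos (-σ)
  have hlt : Real.exp (-σ) < 1 := Real.exp_lt_one_iff.2 (by linarith)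
  rw [hy0]
  have hfe : ∀ τ : ℝ, 0 < τ → Real.exp (-τ) * f (Real.exp (-τ)) =
      (-1) ^ (p - 1) * (truncPow p τ * logKernel 1 (σ - τ)) := by
    intro τ hτ
    have := exp_neg_mul_polylog_integrand 1 σ p hτ
    simpa only [one_mul] using this
  set δ₁ : ℝ → ℝ := fun ε => -Real.log (1 - ε / Real.exp (-σ)) with hδ₁
  set δ₂ : ℝ → ℝ := fun ε => Real.log (1 + ε / Real.exp (-σ)) with hδ₂
  have hsmall : ∀ᶠ ε in 𝓝[>] (0 : ℝ), 0 < ε / Real.exp (-σ) ∧ ε / Real.exp (-σ) ≤ 1 / 2 ∧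
      ε < 1 - Real.exp (-σ) := by
    have h1 : ∀ᶠ ε in 𝓝[>] (0 : ℝ), ε < min (Real.exp (-σ) / 2) (1 - Real.exp (-σ)) :=
      nhdsWithin_le_nhds (Iio_mem_nhds (lt_min (by linarith) (by linarith)))
    filter_upwards [h1, self_mem_nhdsWithin] with ε h2 h3
    have h3' : 0 < ε := h3
    refine ⟨by positivity, ?_, h2.trans_le (min_le_right _ _)⟩
    rw [div_le_iff₀ hpos]
    linarith [h2.trans_le (min_le_left _ _)]
  have hcut : ∀ᶠ ε in 𝓝[>] (0 : ℝ),
      (∫ y in (0 : ℝ)..(Real.exp (-σ) - ε), f y) + ∫ y in (Real.exp (-σ) + ε)..1, f y =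
      (-1) ^ (p - 1) * ((∫ w in Set.Ioi (δ₁ ε), foldedPow 1 p σ w) +
        ∫ w in Set.Ioc (δ₂ ε) (δ₁ ε), truncPow p (σ - w) * logKernel 1 w) := by
    filter_upwards [hsmall] with ε ⟨h1, h2, h3⟩
    obtain ⟨d1, d2, -, -⟩ := log_asymmetry_bounds h1 h2
    have q1 : Real.exp (-σ) - ε = Real.exp (-(σ + δ₁ ε)) := by
      rw [neg_add, Real.exp_add, hδ₁, neg_neg, Real.exp_log (by linarith)]; field_simp
    have q2 : Real.exp (-σ) + ε = Real.exp (-(σ - δ₂ ε)) := by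
      rw [neg_sub, sub_eq_neg_add, Real.exp_add, hδ₂, Real.exp_log (by linarith)]; field_simp
    have hd1 : 0 < δ₁ ε := d1.trans_le d2
    rw [intervalIntegral_eq_Ioo (by rw [q1]; exact (Real.exp_pos _).le),
      intervalIntegral_eq_Ioo (by linarith), q1, q2,
      show (1 : ℝ) = Real.exp (-0) by simp, integral_Ioo_zero_exp_neg, integral_Ioo_exp_neg]
    rw [setIntegral_congr_fun (g := fun τ => (-1) ^ (p - 1) *
        (truncPow p τ * logKernel 1 (σ - τ))) measurableSet_Ioi
        (fun τ hτ => hfe τ (by have : σ + δ₁ ε < τ := hτ; linarith)),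
      setIntegral_congr_fun (g := fun τ => (-1) ^ (p - 1) *
        (truncPow p τ * logKernel 1 (σ - τ))) measurableSet_Ioo (fun τ hτ => hfe τ hτ.1),
      integral_const_mul, integral_const_mul, ← mul_add, truncated_integrals_eq hb p hσ d1 d2]
    simp [hδ₁, hδ₂]
  have hid : Tendsto (fun ε : ℝ => ε / Real.exp (-σ)) (𝓝[>] 0) (𝓝 0) := by
    have : Tendsto (fun ε : ℝ => ε / Real.exp (-σ)) (𝓝 0) (𝓝 (0 / Real.exp (-σ))) :=
      tendsto_id.div_const _
    rw [zero_div] at this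
    exact this.mono_left nhdsWithin_le_nhds
  have hd1 : Tendsto δ₁ (𝓝[>] 0) (𝓝 0) := by
    refine tendsto_of_tendsto_of_tendsto_of_le_of_le' tendsto_const_nhds
      (by simpa using hid.const_mul 2) ?_ ?_
    · filter_upwards [hsmall] with ε ⟨h1, h2, _⟩
      obtain ⟨d1, d2, -, -⟩ := log_asymmetry_bounds h1 h2
      exact d1.le.trans d2
    · filter_upwards [hsmall] with ε ⟨h1, h2, _⟩
      exact (log_asymmetry_bounds h1 h2).2.2.1
  have hmain : Tendsto (fun ε => ∫ w in Set.Ioi (δ₁ ε), foldedPow 1 p σ w) (𝓝[>] 0)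
      (𝓝 (∫ w in Set.Ioi (0 : ℝ), foldedPow 1 p σ w)) := by
    have hc := (aecover_Ioi_of_Ioi (μ := volume) hd1).integral_tendsto_of_countably_generated
      (integrableOn_foldedPow hb p hσ.ne')
    refine hc.congr' ?_
    filter_upwards [hsmall] with ε ⟨h1, h2, _⟩
    obtain ⟨d1, d2, -, -⟩ := log_asymmetry_bounds h1 h2
    rw [Measure.restrict_restrict measurableSet_Ioi,
      Set.inter_eq_left.2 (Set.Ioi_subset_Ioi (d1.le.trans d2))]
  have herr : Tendsto (fun ε => ∫ w in Set.Ioc (δ₂ ε) (δ₁ ε),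
      truncPow p (σ - w) * logKernel 1 w) (𝓝[>] 0) (𝓝 0) := by
    refine squeeze_zero_norm' (a := fun ε => σ ^ (p - 1) * (16 * (ε / Real.exp (-σ)))) ?_
      (by simpa using (hid.const_mul 16).const_mul (σ ^ (p - 1)))
    filter_upwards [hsmall] with ε ⟨h1, h2, _⟩
    obtain ⟨d1, d2, -, d4⟩ := log_asymmetry_bounds h1 h2
    have hn := norm_setIntegral_le_of_norm_le_const (μ := volume) (s := Set.Ioc (δ₂ ε) (δ₁ ε))
      (f := fun w => truncPow p (σ - w) * logKernel 1 w) (C := σ ^ (p - 1) * (2 + (δ₂ ε)⁻¹))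
      (by simp) (fun w hw => by
        refine (abs_truncPow_sub_mul_logKernel_le hb p hσ (d1.trans hw.1)).trans ?_
        have h5 : (w)⁻¹ ≤ (δ₂ ε)⁻¹ := inv_anti₀ d1 hw.1.le
        gcongr)
    refine hn.trans ?_
    rw [Real.volume_real_Ioc_of_le d2, mul_assoc]
    gcongr
  have hlim := (hmain.add herr).const_mul ((-1 : ℝ) ^ (p - 1))
  rw [add_zero] at hlim
  exact (hlim.congr' (hcut.mono fun ε h => h.symm)).limUnder_eq

/-- `Li_p (b e ^ σ)` as an absolutely convergent integral, valid for both signs of `σ`. -/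
theorem polylog_eq_integral_foldedPow {b : ℝ} (hb : b = 1 ∨ b = -1) (p : ℕ) {σ : ℝ} (hσ : σ ≠ 0) :
    polylog p (b * Real.exp σ) =
      b / (Nat.factorial (p - 1) : ℝ) * ∫ w in Set.Ioi (0 : ℝ), foldedPow b p σ w := by
  have hsq : ((-1 : ℝ) ^ (p - 1)) * (-1) ^ (p - 1) = 1 := by rw [← mul_pow]; norm_num
  by_cases h : b = -1 ∨ σ < 0
  · have hle : b * Real.exp σ ≤ 1 := by
      have h0 := Real.exp_pos σ
      rcases hb with rfl | rfl
      · have : σ < 0 := h.resolve_left (by norm_num)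
        rw [one_mul]; exact (Real.exp_lt_one_iff.2 this).le
      · linarith
    rw [polylog, if_pos hle, intervalIntegral_eq_Ioo zero_le_one,
      show (1 : ℝ) = Real.exp (-0) by simp, integral_Ioo_zero_exp_neg]
    rw [setIntegral_congr_fun (g := fun τ => b * (-1) ^ (p - 1) *
        (truncPow p τ * logKernel b (σ - τ))) measurableSet_Ioi (fun τ (hτ : 0 < τ) => by
          have := exp_neg_mul_polylog_integrand b σ p hτ
          simpa using this), integral_const_mul,
      integral_Ioi_truncPow_mul_logKernel_eq p (integrable_truncPow_mul_logKernel hb p h)]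
    simp only [neg_zero, Real.exp_zero]
    linear_combination (b / (Nat.factorial (p - 1) : ℝ) *
      ∫ w in Set.Ioi (0 : ℝ), foldedPow b p σ w) * hsq
  · rw [not_or, not_lt] at h
    obtain rfl : b = 1 := hb.resolve_right h.1
    have hpos : 0 < σ := lt_of_le_of_ne h.2 (Ne.symm hσ)
    have hgt : ¬ Real.exp σ ≤ 1 := not_le.2 (Real.one_lt_exp_iff.2 hpos)
    rw [one_mul, polylog, if_neg hgt, cauchyPV_polylog_integrand p hpos]
    linear_combination (1 / (Nat.factorial (p - 1) : ℝ) *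
      ∫ w in Set.Ioi (0 : ℝ), foldedPow 1 p σ w) * hsq

/-! ### Exchanging the order of integration -/

theorem integrable_abs_rpow_mul_exp_neg {s c : ℝ} (hs : -1 < s) (hc : 0 < c) :
    Integrable (fun σ : ℝ => |σ| ^ s * Real.exp (-(c * |σ|))) := by
  have h1 : IntegrableOn (fun σ : ℝ => |σ| ^ s * Real.exp (-(c * |σ|))) (Set.Ioi 0) :=
    (integrableOn_rpow_mul_exp_neg hs hc).congr_fun
      (fun w (hw : 0 < w) => by rw [abs_of_pos hw]) measurableSet_Ioi
  rw [← neg_zero] at h1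
  have h2 := h1.comp_neg_Iio
  simp only [abs_neg] at h2
  rw [neg_zero] at h1
  rw [← integrableOn_univ, ← Set.Iic_union_Ioi (a := (0 : ℝ)), integrableOn_union,
    integrableOn_Iic_iff_integrableOn_Iio]
  exact ⟨h2, h1⟩

theorem integrable_abs_pow_mul_exp_neg (m : ℕ) {c : ℝ} (hc : 0 < c) :
    Integrable (fun σ : ℝ => |σ| ^ m * Real.exp (-(c * |σ|))) := by
  have := integrable_abs_rpow_mul_exp_neg (s := (m : ℝ))
    (by have := Nat.cast_nonneg (α := ℝ) m; linarith) hc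
  simpa only [Real.rpow_natCast] using this

/-- A differentiable weight which decays exponentially at rate `c` with its derivative. -/
structure ExpDecay (g : ℝ → ℝ) (C c : ℝ) : Prop where
  differentiable : Differentiable ℝ g
  abs_le : ∀ σ, |g σ| ≤ C * Real.exp (-(c * |σ|))
  abs_deriv_le : ∀ σ, |deriv g σ| ≤ C * Real.exp (-(c * |σ|))

namespace ExpDecay

variable {g : ℝ → ℝ} {C c : ℝ}

theorem measurable (hg : ExpDecay g C c) : Measurable g := hg.differentiable.continuous.measurable

theorem nonneg (hg : ExpDecay g C c) : 0 ≤ C := by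
  simpa using (abs_nonneg _).trans (hg.abs_le 0)

theorem abs_shift_le (hg : ExpDecay g C c) (hc : 0 ≤ c) {x y : ℝ} (h : y ≤ |x|) :
    |g x| ≤ C * Real.exp (-(c * y)) := by
  refine (hg.abs_le x).trans ?_
  have := hg.nonneg
  gcongr

theorem integrable (hg : ExpDecay g C c) (hc : 0 < c) : Integrable g := by
  have h0 := (integrable_abs_pow_mul_exp_neg 0 hc).const_mul C
  refine Integrable.mono' h0 hg.measurable.aestronglyMeasurable (Eventually.of_forall fun σ => ?_)
  simpa using hg.abs_le σ

theorem abs_sub_le (hg : ExpDecay g C c) (hc : 0 ≤ c) (τ : ℝ) {w : ℝ} (hw : 0 < w) :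
    |g (τ - w) - g (τ + w)| ≤ C * Real.exp (-(c * (τ - w))) * (2 * w) := by
  have h := (convex_Icc (τ - w) (τ + w)).norm_image_sub_le_of_norm_deriv_le (f := g)
    (C := C * Real.exp (-(c * (τ - w)))) (x := τ + w) (y := τ - w)
    (fun x _ => hg.differentiable x) (fun x hx => by
      refine (hg.abs_deriv_le x).trans ?_
      have := hg.nonneg
      have h2 : τ - w ≤ |x| := hx.1.trans (le_abs_self x)
      gcongr)
    ⟨by linarith, le_rfl⟩ ⟨le_rfl, by linarith⟩
  rw [Real.norm_eq_abs, Real.norm_eq_abs, show τ - w - (τ + w) = -(2 * w) by ring, abs_neg,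
    abs_of_pos (by linarith : 0 < 2 * w)] at h
  exact h

theorem integrable_mul_foldedPow (hg : ExpDecay g C c) (hc : 0 < c) {b : ℝ}
    (hb : b = 1 ∨ b = -1) (p : ℕ) :
    Integrable (fun z : ℝ × ℝ => g z.1 * foldedPow b p z.1 z.2)
      (volume.prod (volume.restrict (Set.Ioi 0))) := by
  have hc2 : 0 < c / 2 := by linarith
  have i0 : IntegrableOn (fun w : ℝ => Real.exp (-(c / 2 * w))) (Set.Ioi 0) := by
    simpa using integrableOn_pow_mul_exp_neg 0 hc2
  have d0 := ((integrable_abs_pow_mul_exp_neg (p - 1) hc2).const_mul C).mul_prod i0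
  have d1 := ((integrable_abs_rpow_mul_exp_neg (s := -(1 / 2)) (by norm_num) hc).const_mul
    C).mul_prod (integrableOn_jump_weight p)
  have d2 := ((integrable_abs_pow_mul_exp_neg (p - 1 - 1) hc).const_mul
    (C * (2 * ((p - 1 : ℕ) : ℝ) * 2 ^ (p - 1 - 1)))).mul_prod integrableOn_smooth_weight
  refine Integrable.mono' (d0.add (d1.add d2)) ?_ ?_
  · exact ((hg.measurable.comp measurable_fst).mul
      (measurable_foldedPow_uncurry b p)).aestronglyMeasurable
  have ae1 : ∀ᵐ z ∂((volume : Measure ℝ).prod (volume.restrict (Set.Ioi (0 : ℝ)))), z.1 ≠ 0 :=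
    Measure.quasiMeasurePreserving_fst.ae (Measure.ae_ne volume 0)
  have ae2 : ∀ᵐ z ∂((volume : Measure ℝ).prod (volume.restrict (Set.Ioi (0 : ℝ)))),
      z.2 ∈ Set.Ioi (0 : ℝ) :=
    Measure.quasiMeasurePreserving_snd.ae (ae_restrict_mem measurableSet_Ioi)
  filter_upwards [ae1, ae2] with z h1 h2
  have h2' : 0 < z.2 := h2
  have hC := hg.nonneg
  have hexp : Real.exp (-(c * |z.1|)) * Real.exp (c / 2 * |z.1|) = Real.exp (-(c / 2 * |z.1|)) := by
    rw [← Real.exp_add]; congr 1; ring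
  rw [norm_mul, Real.norm_eq_abs, Real.norm_eq_abs]
  refine (mul_le_mul (hg.abs_le z.1) (abs_foldedPow_le hb p hc2.le h1 h2') (abs_nonneg _)
    (by positivity)).trans (le_of_eq ?_)
  simp only [Pi.add_apply]
  rw [← hexp, mul_pow 2 |z.1|]
  ring

theorem integrable_truncPow_mul_exp_neg (p : ℕ) (hc : 0 < c) :
    Integrable (fun τ => truncPow p τ * Real.exp (-(c * τ))) := by
  have h : (fun τ => truncPow p τ * Real.exp (-(c * τ))) =
      (Set.Ioi (0 : ℝ)).indicator (fun τ => τ ^ (p - 1) * Real.exp (-(c * τ))) := by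
    ext τ
    by_cases h : 0 < τ
    · rw [Set.indicator_of_mem (Set.mem_Ioi.2 h), truncPow_of_pos h]
    · rw [Set.indicator_of_notMem (by simpa using h), truncPow_of_nonpos (not_lt.1 h), zero_mul]
  rw [h]
  exact (integrable_indicator_iff measurableSet_Ioi).2 (integrableOn_pow_mul_exp_neg (p - 1) hc)

theorem integrable_truncPow_mul_fold (hg : ExpDecay g C c) (hc : 0 < c) (hc1 : c < 1) {b : ℝ}
    (hb : b = 1 ∨ b = -1) (p : ℕ) :
    Integrable (fun z : ℝ × ℝ => truncPow p z.1 *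
      (g (z.1 + z.2) * logKernel b z.2 + g (z.1 - z.2) * logKernel b (-z.2)))
      (volume.prod (volume.restrict (Set.Ioi 0))) := by
  have i0 : IntegrableOn (fun w : ℝ => C * Real.exp (-(c * w)) +
      2 * C * (w ^ 1 * Real.exp (-((1 - c) * w)) + w ^ 0 * Real.exp (-((1 - c) * w))))
      (Set.Ioi 0) := by
    have j0 := integrableOn_pow_mul_exp_neg 0 hc
    simp only [pow_zero, one_mul] at j0
    exact (j0.const_mul C).add
      (((integrableOn_pow_mul_exp_neg 1 (sub_pos.2 hc1)).add
        (integrableOn_pow_mul_exp_neg 0 (sub_pos.2 hc1))).const_mul (2 * C))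
  refine Integrable.mono' ((integrable_truncPow_mul_exp_neg p hc).mul_prod i0) ?_ ?_
  · have := hg.measurable
    exact Measurable.aestronglyMeasurable (by fun_prop)
  have ae2 : ∀ᵐ z ∂((volume : Measure ℝ).prod (volume.restrict (Set.Ioi (0 : ℝ)))),
      z.2 ∈ Set.Ioi (0 : ℝ) :=
    Measure.quasiMeasurePreserving_snd.ae (ae_restrict_mem measurableSet_Ioi)
  filter_upwards [ae2] with z hz
  obtain ⟨τ, w⟩ := z
  have hw : 0 < w := hz
  have hb1 : |-b| = 1 := by rcases hb with rfl | rfl <;> simp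
  simp only
  rw [norm_mul, Real.norm_eq_abs, Real.norm_eq_abs, abs_of_nonneg (truncPow_nonneg p τ), mul_assoc]
  by_cases hτ : 0 < τ
  · refine mul_le_mul_of_nonneg_left ?_ (truncPow_nonneg p τ)
    have e : g (τ + w) * logKernel b w + g (τ - w) * logKernel b (-w) =
        -b * g (τ + w) + logKernel b (-w) * (g (τ - w) - g (τ + w)) := by
      rw [logKernel_eq hb hw]; ring
    have h1 : |g (τ + w)| ≤ C * Real.exp (-(c * (τ + w))) :=
      hg.abs_shift_le hc.le (le_abs_self _)
    have h2 := hg.abs_sub_le hc.le τ hw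
    have e1 : Real.exp (-(c * (τ + w))) = Real.exp (-(c * τ)) * Real.exp (-(c * w)) := by
      rw [← Real.exp_add]; congr 1; ring
    have e2 : Real.exp (-w) * Real.exp (-(c * (τ - w))) =
        Real.exp (-(c * τ)) * Real.exp (-((1 - c) * w)) := by
      rw [← Real.exp_add, ← Real.exp_add]; congr 1; ring
    have h3 : logKernel b (-w) * |g (τ - w) - g (τ + w)| ≤
        Real.exp (-w) * (1 + w⁻¹) * (C * Real.exp (-(c * (τ - w))) * (2 * w)) :=
      mul_le_mul (logKernel_neg_le hb hw) h2 (abs_nonneg _) (by positivity)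
    rw [e]
    refine (abs_add_le _ _).trans ?_
    rw [abs_mul, abs_mul, hb1, one_mul, abs_of_nonneg (logKernel_neg_nonneg hb hw)]
    refine (add_le_add h1 h3).trans (le_of_eq ?_)
    have e3 : Real.exp (-w) * (1 + w⁻¹) * (C * Real.exp (-(c * (τ - w))) * (2 * w)) =
        2 * C * (w + 1) * (Real.exp (-w) * Real.exp (-(c * (τ - w)))) := by
      field_simp
    rw [e3, e1, e2]; ring
  · rw [truncPow_of_nonpos (not_lt.1 hτ)]; simp

theorem integrable_shift_mul_truncPow (hg : ExpDecay g C c) (hc : 0 < c) (p : ℕ) (w : ℝ) :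
    Integrable (fun τ => g (τ + w) * truncPow p τ) := by
  have hm := hg.measurable
  refine Integrable.mono' ((integrable_truncPow_mul_exp_neg p hc).const_mul
    (C * Real.exp (c * |w|))) (Measurable.aestronglyMeasurable (by fun_prop))
    (Eventually.of_forall fun τ => ?_)
  rw [norm_mul, Real.norm_eq_abs, Real.norm_eq_abs, abs_of_nonneg (truncPow_nonneg p τ)]
  have h1 : |g (τ + w)| ≤ C * Real.exp (-(c * (τ - |w|))) := by
    refine hg.abs_shift_le hc.le ?_
    have := neg_abs_le w
    exact le_trans (by linarith) (le_abs_self _)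
  have e : Real.exp (-(c * (τ - |w|))) = Real.exp (c * |w|) * Real.exp (-(c * τ)) := by
    rw [← Real.exp_add]; congr 1; ring
  rw [e] at h1
  refine (mul_le_mul_of_nonneg_right h1 (truncPow_nonneg p τ)).trans (le_of_eq (by ring))

theorem integral_mul_foldedPow_slice (hg : ExpDecay g C c) (hc : 0 < c) (b : ℝ) (p : ℕ) (w : ℝ) :
    ∫ σ, g σ * foldedPow b p σ w = ∫ τ, truncPow p τ *
      (g (τ + w) * logKernel b w + g (τ - w) * logKernel b (-w)) := by
  have i1 := hg.integrable_shift_mul_truncPow hc p w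
  have i2 := hg.integrable_shift_mul_truncPow hc p (-w)
  have j1 : Integrable (fun σ => g σ * truncPow p (σ - w)) := by
    simpa using i1.comp_sub_right w
  have j2 : Integrable (fun σ => g σ * truncPow p (σ + w)) := by
    simpa using i2.comp_add_right w
  have e1 : ∫ σ, g σ * truncPow p (σ - w) = ∫ τ, g (τ + w) * truncPow p τ := by
    simpa using (integral_add_right_eq_self (fun σ => g σ * truncPow p (σ - w)) w).symm
  have e2 : ∫ σ, g σ * truncPow p (σ + w) = ∫ τ, g (τ + -w) * truncPow p τ := by
    simpa using (integral_add_right_eq_self (fun σ => g σ * truncPow p (σ + w)) (-w)).symm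
  calc ∫ σ, g σ * foldedPow b p σ w
      = ∫ σ, ((g σ * truncPow p (σ - w)) * logKernel b w +
          (g σ * truncPow p (σ + w)) * logKernel b (-w)) := by
        congr 1; ext σ; rw [foldedPow]; ring
    _ = (∫ τ, g (τ + w) * truncPow p τ) * logKernel b w +
          (∫ τ, g (τ + -w) * truncPow p τ) * logKernel b (-w) := by
        rw [integral_add (j1.mul_const _) (j2.mul_const _), integral_mul_const,
          integral_mul_const, e1, e2]
    _ = ∫ τ, ((g (τ + w) * truncPow p τ) * logKernel b w +
          (g (τ + -w) * truncPow p τ) * logKernel b (-w)) := by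
        rw [integral_add (i1.mul_const _) (i2.mul_const _), integral_mul_const,
          integral_mul_const]
    _ = _ := by
        congr 1; ext τ; rw [sub_eq_add_neg]; ring

/-- Folding both principal values at the pole makes the double integral absolutely convergent in
either order, so that Fubini's theorem moves the kernel from the power of `τ` to the weight `g`. -/
theorem integral_mul_polylog (hg : ExpDecay g C c) (hc : 0 < c) (hc1 : c < 1) {b : ℝ}
    (hb : b = 1 ∨ b = -1) (p : ℕ) :
    Integrable (fun σ => g σ * polylog p (b * Real.exp σ)) ∧
    ∫ σ, g σ * polylog p (b * Real.exp σ) =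
      b / (Nat.factorial (p - 1) : ℝ) * ∫ τ in Set.Ioi (0 : ℝ), τ ^ (p - 1) *
        ∫ w in Set.Ioi (0 : ℝ), (g (τ + w) * logKernel b w + g (τ - w) * logKernel b (-w)) := by
  have hae : (fun σ => g σ * polylog p (b * Real.exp σ)) =ᵐ[volume] fun σ =>
      b / (Nat.factorial (p - 1) : ℝ) *
        ∫ w in Set.Ioi (0 : ℝ), g σ * foldedPow b p σ w := by
    filter_upwards [Measure.ae_ne volume (0 : ℝ)] with σ hσ
    rw [polylog_eq_integral_foldedPow hb p hσ, integral_const_mul]; ring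
  have I1 := hg.integrable_mul_foldedPow hc hb p
  have I2 := hg.integrable_truncPow_mul_fold hc hc1 hb p
  refine ⟨(I1.integral_prod_left.const_mul _).congr hae.symm, ?_⟩
  rw [integral_congr_ae hae, integral_const_mul, integral_integral_swap I1]
  simp_rw [hg.integral_mul_foldedPow_slice hc b p]
  rw [← integral_integral_swap I2]
  congr 1
  rw [← setIntegral_eq_integral_of_forall_compl_eq_zero (s := Set.Ioi (0 : ℝ))]
  · refine setIntegral_congr_fun measurableSet_Ioi fun τ (hτ : 0 < τ) => ?_
    rw [integral_const_mul, truncPow_of_pos hτ]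
  · intro τ hτ
    simp only [Set.mem_Ioi, not_lt] at hτ
    simp [truncPow_of_nonpos hτ]

end ExpDecay

/-! ### The weight `σ ^ (q - 1) e ^ (β σ) / (1 - a e ^ (2 β σ))` -/

theorem abs_pow_mul_exp_neg_le (m : ℕ) {d : ℝ} (hd : 0 < d) (x : ℝ) :
    |x| ^ m * Real.exp (-(d * |x|)) ≤ (Nat.factorial m : ℝ) / d ^ m := by
  have h := Real.pow_div_factorial_le_exp (d * |x|) (by positivity) m
  rw [Real.exp_neg, ← div_eq_mul_inv, div_le_div_iff₀ (Real.exp_pos _) (by positivity)]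
  rw [div_le_iff₀ (by positivity), mul_pow] at h
  linarith

/-- Multiplying by a power and rescaling costs an arbitrarily small part of the decay rate. -/
theorem ExpDecay.pow_mul_comp {U : ℝ → ℝ} {K : ℝ} (hU : ExpDecay U K (3 / 4)) (m : ℕ) {β : ℝ}
    (hβ : 0 < β) : ∃ C, ExpDecay (fun σ => σ ^ m * U (β * σ)) C (β / 2) := by
  have hK := hU.nonneg
  have hsplit : ∀ σ : ℝ, Real.exp (-(3 / 4 * |β * σ|)) =
      Real.exp (-(β / 4 * |σ|)) * Real.exp (-(β / 2 * |σ|)) := by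
    intro σ; rw [← Real.exp_add, abs_mul, abs_of_pos hβ]; congr 1; ring
  set D : ℕ → ℝ := fun j => (Nat.factorial j : ℝ) / (β / 4) ^ j with hD
  have hD0 : ∀ j, 0 ≤ D j := fun j => by positivity
  have key : ∀ (V : ℝ → ℝ), (∀ s, |V s| ≤ K * Real.exp (-(3 / 4 * |s|))) → ∀ (j : ℕ) (σ : ℝ),
      |σ ^ j * V (β * σ)| ≤ K * D j * Real.exp (-(β / 2 * |σ|)) := by
    intro V hV j σ
    rw [abs_mul, abs_pow]
    calc |σ| ^ j * |V (β * σ)| ≤ |σ| ^ j * (K * Real.exp (-(3 / 4 * |β * σ|))) := by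
          gcongr; exact hV _
      _ = K * (|σ| ^ j * Real.exp (-(β / 4 * |σ|))) * Real.exp (-(β / 2 * |σ|)) := by
          rw [hsplit]; ring
      _ ≤ _ := by gcongr; exact abs_pow_mul_exp_neg_le j (by positivity) σ
  have hd : ∀ σ, HasDerivAt (fun σ => σ ^ m * U (β * σ))
      ((m : ℝ) * (σ ^ (m - 1) * U (β * σ)) + β * (σ ^ m * deriv U (β * σ))) σ := by
    intro σ
    have h1 : HasDerivAt (fun σ => U (β * σ)) (deriv U (β * σ) * β) σ := by
      have h2 : HasDerivAt (fun σ => β * σ) β σ := by simpa using (hasDerivAt_id σ).const_mul β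
      exact (hU.differentiable (β * σ)).hasDerivAt.comp σ h2
    refine ((hasDerivAt_pow m σ).mul h1).congr_deriv ?_
    ring
  refine ⟨K * D m + ((m : ℝ) * (K * D (m - 1)) + β * (K * D m)),
    fun σ => (hd σ).differentiableAt, fun σ => ?_, fun σ => ?_⟩
  · refine (key U hU.abs_le m σ).trans ?_
    have h1 : 0 ≤ (m : ℝ) * (K * D (m - 1)) + β * (K * D m) := by
      have := hD0 m; have := hD0 (m - 1); positivity
    gcongr
    linarith
  · rw [(hd σ).deriv]
    have h1 := key U hU.abs_le (m - 1) σ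
    have h2 := key (deriv U) hU.abs_deriv_le m σ
    have h3 : 0 ≤ K * D m := mul_nonneg hK (hD0 m)
    refine (abs_add_le _ _).trans ?_
    rw [abs_mul (m : ℝ), abs_mul β, abs_of_pos hβ, abs_of_nonneg (Nat.cast_nonneg m : (0 : ℝ) ≤ m)]
    have h4 := mul_le_mul_of_nonneg_left h1 (Nat.cast_nonneg m : (0 : ℝ) ≤ m)
    have h5 := mul_le_mul_of_nonneg_left h2 hβ.le
    have h6 := mul_nonneg h3 (Real.exp_pos (-(β / 2 * |σ|))).le
    linarith

theorem ExpDecay.const_mul {U : ℝ → ℝ} {K c : ℝ} (hU : ExpDecay U K c) (r : ℝ) :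
    ExpDecay (fun s => r * U s) (|r| * K) c where
  differentiable := hU.differentiable.const_mul r
  abs_le s := by rw [abs_mul, mul_assoc]; gcongr; exact hU.abs_le s
  abs_deriv_le s := by
    rw [deriv_const_mul _ (hU.differentiable s), abs_mul, mul_assoc]; gcongr
    exact hU.abs_deriv_le s

theorem inv_cosh_le (s : ℝ) : (Real.cosh s)⁻¹ ≤ 2 * Real.exp (-(3 / 4 * |s|)) := by
  rw [Real.exp_neg, ← div_eq_mul_inv, inv_eq_one_div,
    div_le_div_iff₀ (Real.cosh_pos s) (Real.exp_pos _), one_mul, ← Real.cosh_abs, Real.cosh_eq]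
  have h1 : Real.exp (3 / 4 * |s|) ≤ Real.exp |s| := by
    apply Real.exp_le_exp.2; linarith [abs_nonneg s]
  linarith [Real.exp_pos (-|s|)]

theorem expDecay_inv_cosh : ExpDecay (fun s => (Real.cosh s)⁻¹) 2 (3 / 4) where
  differentiable := Real.differentiable_cosh.inv fun s => (Real.cosh_pos s).ne'
  abs_le s := by
    rw [abs_of_pos (inv_pos.2 (Real.cosh_pos s))]; exact inv_cosh_le s
  abs_deriv_le s := by
    have hc := Real.cosh_pos s
    have h := ((Real.hasDerivAt_cosh s).inv hc.ne').deriv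
    have h2 : |Real.sinh s| ≤ Real.cosh s := by
      rw [← abs_of_pos hc, ← sq_le_sq]
      have := Real.cosh_sq s; linarith
    have e : deriv (fun s => (Real.cosh s)⁻¹) s = -Real.sinh s / Real.cosh s ^ 2 := h
    rw [e, abs_div, abs_neg, abs_of_pos (pow_pos hc 2)]
    refine le_trans ?_ (inv_cosh_le s)
    rw [div_le_iff₀ (by positivity), pow_two, inv_mul_cancel_left₀ hc.ne']
    exact h2

/-- `s / sinh s`, with its limit `1` at `s = 0`. -/
noncomputable def invSinhc (s : ℝ) : ℝ := (dslope Real.sinh 0 s)⁻¹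

theorem invSinhc_of_ne {s : ℝ} (hs : s ≠ 0) : invSinhc s = s / Real.sinh s := by
  rw [invSinhc, dslope_of_ne _ hs, slope_def_field, Real.sinh_zero, sub_zero, sub_zero, inv_div]

theorem hasDerivAt_invSinhc {s : ℝ} (hs : s ≠ 0) :
    HasDerivAt invSinhc ((Real.sinh s - s * Real.cosh s) / Real.sinh s ^ 2) s := by
  have h : HasDerivAt (fun s => s / Real.sinh s)
      ((1 * Real.sinh s - s * Real.cosh s) / Real.sinh s ^ 2) s :=
    (hasDerivAt_id s).div (Real.hasDerivAt_sinh s) (by simpa using hs)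
  rw [one_mul] at h
  refine h.congr_of_eventuallyEq ?_
  filter_upwards [isOpen_ne.mem_nhds hs] with x hx using invSinhc_of_ne hx

theorem differentiable_invSinhc : Differentiable ℝ invSinhc := by
  intro s
  by_cases hs : s = 0
  · subst hs
    have ha : AnalyticAt ℝ Real.sinh 0 := Real.analyticAt_sinh
    obtain ⟨f, hf⟩ := ha
    have h1 : AnalyticAt ℝ (dslope Real.sinh 0) 0 := ⟨_, hf.has_fpower_series_dslope_fslope⟩
    refine h1.differentiableAt.inv ?_
    rw [dslope_same, Real.deriv_sinh, Real.cosh_zero]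
    exact one_ne_zero
  · exact (hasDerivAt_invSinhc hs).differentiableAt

theorem self_mul_exp_neg_le (x : ℝ) :
    x * Real.exp (-x) ≤ 4 * Real.exp (-(3 / 4 * x)) := by
  have h1 : x ≤ 4 * Real.exp (x / 4) := by linarith [Real.add_one_le_exp (x / 4)]
  have e : Real.exp (-(3 / 4 * x)) = Real.exp (x / 4) * Real.exp (-x) := by
    rw [← Real.exp_add]; congr 1; ring
  rw [e]
  nlinarith [Real.exp_pos (-x)]

theorem div_sinh_le {x : ℝ} (hx : 0 < x) : x / Real.sinh x ≤ 9 * Real.exp (-(3 / 4 * x)) := by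
  have h1 := inv_one_sub_sign_mul_exp_neg_le (Or.inl rfl : (1 : ℝ) = 1 ∨ (1 : ℝ) = -1)
    (by linarith : 0 < 2 * x)
  have h0 := one_sub_sign_mul_exp_neg_pos (Or.inl rfl : (1 : ℝ) = 1 ∨ (1 : ℝ) = -1)
    (by linarith : 0 < 2 * x)
  have e : Real.sinh x = (1 - 1 * Real.exp (-(2 * x))) / (2 * Real.exp (-x)) := by
    have h2 : Real.exp (-(2 * x)) = Real.exp (-x) * Real.exp (-x) := by
      rw [← Real.exp_add]; congr 1; ring
    have h3 : Real.exp x * Real.exp (-x) = 1 := by rw [← Real.exp_add]; simp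
    rw [Real.sinh_eq, h2]
    field_simp
    linear_combination h3
  have h4 : Real.exp (-x) ≤ Real.exp (-(3 / 4 * x)) := Real.exp_le_exp.2 (by linarith)
  have h5 := self_mul_exp_neg_le x
  calc x / Real.sinh x = 2 * x * Real.exp (-x) * (1 - 1 * Real.exp (-(2 * x)))⁻¹ := by
        rw [e]; field_simp
    _ ≤ 2 * x * Real.exp (-x) * (1 + (2 * x)⁻¹) := by gcongr
    _ = 2 * (x * Real.exp (-x)) + Real.exp (-x) := by field_simp
    _ ≤ _ := by linarith

theorem deriv_div_sinh_le {x : ℝ} (hx : 0 < x) :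
    |(Real.sinh x - x * Real.cosh x) / Real.sinh x ^ 2| ≤ 9 * Real.exp (-(3 / 4 * x)) := by
  have hs : 0 < Real.sinh x := Real.sinh_pos_iff.2 hx
  have hc := Real.cosh_pos x
  have h1 : x ≤ Real.sinh x := Real.self_le_sinh_iff.2 hx.le
  have h2 : Real.cosh x ^ 2 = Real.sinh x ^ 2 + 1 := Real.cosh_sq x
  have h3 : Real.sinh x ≤ x * Real.cosh x := by
    -- `sinh x = ∫ cosh ≤ x cosh x`, via the mean value theorem
    obtain ⟨ξ, ⟨hξ0, hξx⟩, hξ⟩ := exists_deriv_eq_slope Real.sinh hx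
      Real.continuous_sinh.continuousOn (Real.differentiable_sinh.differentiableOn)
    rw [Real.deriv_sinh, Real.sinh_zero, sub_zero, sub_zero, eq_div_iff hx.ne'] at hξ
    rw [← hξ, mul_comm]
    gcongr
    rw [Real.cosh_le_cosh, abs_of_pos hξ0, abs_of_pos hx]
    exact hξx.le
  rw [abs_div, abs_of_nonpos (by linarith), abs_of_pos (pow_pos hs 2)]
  have h4 : -(Real.sinh x - x * Real.cosh x) / Real.sinh x ^ 2 ≤ x / (Real.cosh x + 1) := by
    rw [div_le_div_iff₀ (by positivity) (by linarith)]
    nlinarith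
  refine h4.trans ?_
  have h5 : Real.exp x / 2 ≤ Real.cosh x + 1 := by
    rw [Real.cosh_eq]; linarith [Real.exp_pos (-x)]
  have h6 := self_mul_exp_neg_le x
  calc x / (Real.cosh x + 1) ≤ x / (Real.exp x / 2) := by gcongr
    _ = 2 * (x * Real.exp (-x)) := by rw [Real.exp_neg]; field_simp
    _ ≤ _ := by linarith [Real.exp_pos (-(3 / 4 * x))]

theorem exists_expDecay_invSinhc : ∃ K, ExpDecay invSinhc K (3 / 4) := by
  refine ⟨9 + |deriv invSinhc 0|, differentiable_invSinhc, fun s => ?_, fun s => ?_⟩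
  · have h9 : |invSinhc s| ≤ 9 * Real.exp (-(3 / 4 * |s|)) := by
      by_cases hs : s = 0
      · subst hs
        rw [invSinhc, dslope_same, Real.deriv_sinh, Real.cosh_zero]; norm_num
      · rw [invSinhc_of_ne hs, abs_div, Real.abs_sinh]
        exact div_sinh_le (abs_pos.2 hs)
    refine h9.trans ?_
    gcongr
    linarith [abs_nonneg (deriv invSinhc 0)]
  · by_cases hs : s = 0
    · subst hs; simp
    · have h9 : |deriv invSinhc s| ≤ 9 * Real.exp (-(3 / 4 * |s|)) := by
        rw [(hasDerivAt_invSinhc hs).deriv]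
        refine le_trans (le_of_eq ?_) (deriv_div_sinh_le (abs_pos.2 hs))
        rcases abs_choice s with h | h <;> rw [h]
        rw [Real.sinh_neg, Real.cosh_neg, abs_div, abs_div, ← abs_neg]
        congr 2 <;> ring
      refine h9.trans ?_
      gcongr
      linarith [abs_nonneg (deriv invSinhc 0)]

/-- For `a = 1` the factor `σ ^ (q - 1)`, with `q ≥ 2`, cancels the pole of
`1 / (1 - e ^ (2 β σ))` at `σ = 0`. The weight then agrees with a differentiable function of
exponential decay except at `σ = 0`, where the junk value of a division by zero can differ from
the limit. -/
theorem exists_expDecay_weight {a : ℝ} (ha : a = 1 ∨ a = -1) {q : ℕ} (hq : 1 ≤ q)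
    (hqa : a = 1 → q ≠ 1) {β : ℝ} (hβ : 0 < β) :
    ∃ (g : ℝ → ℝ) (C : ℝ), ExpDecay g C (β / 2) ∧ ∀ σ, σ ≠ 0 →
      g σ = σ ^ (q - 1) * Real.exp (β * σ) / (1 - a * Real.exp (2 * β * σ)) := by
  have hexp : ∀ σ : ℝ, Real.exp (2 * β * σ) = Real.exp (β * σ) * Real.exp (β * σ) := by
    intro σ; rw [← Real.exp_add]; congr 1; ring
  have hinv : ∀ σ : ℝ, Real.exp (β * σ) * Real.exp (-(β * σ)) = 1 := by
    intro σ; rw [← Real.exp_add]; simp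
  rcases ha with rfl | rfl
  · obtain ⟨m, rfl⟩ : ∃ m, q = m + 2 := ⟨q - 2, by have := hqa rfl; omega⟩
    obtain ⟨K, hK⟩ := exists_expDecay_invSinhc
    obtain ⟨C, hC⟩ := hK.pow_mul_comp m hβ
    refine ⟨_, _, hC.const_mul (-(2 * β)⁻¹), fun σ hσ => ?_⟩
    have hβσ : β * σ ≠ 0 := mul_ne_zero hβ.ne' hσ
    have hs : Real.sinh (β * σ) ≠ 0 := by simpa using hβσ
    have e : 1 - 1 * Real.exp (2 * β * σ) =
        -2 * Real.exp (β * σ) * Real.sinh (β * σ) := by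
      rw [hexp, Real.sinh_eq]; linear_combination -hinv σ
    have h1 := (Real.exp_pos (β * σ)).ne'
    rw [invSinhc_of_ne hβσ, e, show m + 2 - 1 = m + 1 by omega, pow_succ]
    field_simp
  · obtain ⟨C, hC⟩ := expDecay_inv_cosh.pow_mul_comp (q - 1) hβ
    refine ⟨_, _, hC.const_mul (1 / 2), fun σ _ => ?_⟩
    have hs := (Real.cosh_pos (β * σ)).ne'
    have e : 1 - -1 * Real.exp (2 * β * σ) = 2 * Real.exp (β * σ) * Real.cosh (β * σ) := by
      rw [hexp, Real.cosh_eq]; linear_combination -hinv σ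
    have h1 := (Real.exp_pos (β * σ)).ne'
    rw [e]
    field_simp

/-! ### Partial fractions and evaluation -/

theorem pow_eq_one_or_neg_one {a : ℝ} (ha : a = 1 ∨ a = -1) (n : ℕ) : a ^ n = 1 ∨ a ^ n = -1 := by
  rcases ha with rfl | rfl
  · simp
  · exact neg_one_pow_eq_or ℝ n

theorem one_sub_sign_mul_exp_ne_zero {a σ : ℝ} (ha : a = 1 ∨ a = -1) (hσ : σ ≠ 0) :
    1 - a * Real.exp σ ≠ 0 := by
  rcases ha with rfl | rfl
  · rw [one_mul, sub_ne_zero, ne_comm, Ne, Real.exp_eq_one_iff]; exact hσ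
  · linarith [Real.exp_pos σ]

theorem logKernel_eq_div (b σ τ : ℝ) :
    logKernel b (σ - τ) = Real.exp σ * Real.exp (-τ) / (1 - b * Real.exp (σ - τ)) := by
  have h := logKernel_neg_eq (b := b) (τ - σ)
  rw [show -(τ - σ) = σ - τ by ring] at h
  rw [h, sub_eq_add_neg σ τ, Real.exp_add]

theorem sum_Icc_pow_pred_mul_one_sub (y : ℝ) (n : ℕ) :
    (∑ j ∈ Finset.Icc 1 n, y ^ (j - 1)) * (1 - y) = 1 - y ^ n := by
  induction n with
  | zero => simp
  | succ n ih =>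
    rw [Finset.sum_Icc_succ_top (by omega), add_mul, ih, Nat.add_sub_cancel]; ring

theorem add_pow_eq_sum_Icc (x y : ℝ) {q : ℕ} (hq : 1 ≤ q) :
    (x + y) ^ (q - 1) = ∑ k ∈ Finset.Icc 1 q,
      (Nat.choose (q - 1) (k - 1) : ℝ) * x ^ (q - k) * y ^ (k - 1) := by
  obtain ⟨m, rfl⟩ : ∃ m, q = m + 1 := ⟨q - 1, by omega⟩
  rw [Nat.add_sub_cancel, add_comm x y, add_pow,
    Finset.sum_bij (fun i _ => i + 1) (t := Finset.Icc 1 (m + 1))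
      (g := fun k => (Nat.choose m (k - 1) : ℝ) * x ^ (m + 1 - k) * y ^ (k - 1))]
  · intro i hi; simp at hi ⊢; omega
  · intro i _ j _ h; omega
  · intro k hk
    simp only [Finset.mem_Icc] at hk
    exact ⟨k - 1, by simp; omega, by omega⟩
  · intro i _
    rw [Nat.add_sub_cancel, Nat.add_sub_add_right]; ring

/-- Partial fractions in `x = e ^ (2 β σ)`, where `x ^ n = e ^ σ`: the difference between
`x ^ n e ^ (-τ) / ((1 - a x) (1 - b x ^ n e ^ (-τ)))` and its principal part at `a x = 1` is a
geometric sum over the denominator `1 - b x ^ n e ^ (-τ)`. -/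
theorem partial_fractions {a b : ℝ} (ha : a = 1 ∨ a = -1) (hb : b = 1 ∨ b = -1) {n : ℕ}
    (hn : 1 ≤ n) {σ τ : ℝ} (hσ : σ ≠ 0) (hτ : 0 < τ) (hστ : σ ≠ τ) :
    Real.exp (1 / (2 * n) * σ) / (1 - a * Real.exp (2 * (1 / (2 * n)) * σ)) * logKernel b (σ - τ) =
      a ^ n * (Real.exp (-τ) / (1 - a ^ n * b * Real.exp (-τ))) *
        (Real.exp (1 / (2 * n) * σ) / (1 - a * Real.exp (2 * (1 / (2 * n)) * σ)) -
          ∑ j ∈ Finset.Icc 1 n, a ^ (j - 1) *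
            (Real.exp ((2 * j - 1) / (2 * n) * σ) / (1 - b * Real.exp (σ - τ)))) := by
  have hn0 : (n : ℝ) ≠ 0 := by positivity
  have hc : a ^ n * b = 1 ∨ a ^ n * b = -1 := by
    rcases pow_eq_one_or_neg_one ha n with h | h <;> rcases hb with rfl | rfl <;> simp [h]
  have ha2 : a ^ n * a ^ n = 1 := by
    rcases pow_eq_one_or_neg_one ha n with h | h <;> rw [h] <;> norm_num
  set X := Real.exp (1 / (2 * n) * σ) with hX
  set x := Real.exp (2 * (1 / (2 * n)) * σ) with hx
  have hxn : x ^ n = Real.exp σ := by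
    rw [hx, ← Real.exp_nat_mul]; congr 1; field_simp
  have h1 : 1 - a * x ≠ 0 := one_sub_sign_mul_exp_ne_zero ha (by positivity)
  have h2 : 1 - b * Real.exp (σ - τ) ≠ 0 := one_sub_sign_mul_exp_ne_zero hb (sub_ne_zero.2 hστ)
  have h3 : 1 - a ^ n * b * Real.exp (-τ) ≠ 0 := (one_sub_sign_mul_exp_neg_pos hc hτ).ne'
  have hsum : ∑ j ∈ Finset.Icc 1 n, a ^ (j - 1) *
      (Real.exp ((2 * j - 1) / (2 * n) * σ) / (1 - b * Real.exp (σ - τ))) =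
      X / (1 - b * Real.exp (σ - τ)) * ((1 - a ^ n * x ^ n) / (1 - a * x)) := by
    rw [eq_comm, ← mul_pow, ← sum_Icc_pow_pred_mul_one_sub, mul_div_cancel_right₀ _ h1,
      Finset.mul_sum]
    refine Finset.sum_congr rfl fun j hj => ?_
    have hj1 : 1 ≤ j := (Finset.mem_Icc.1 hj).1
    have e : Real.exp ((2 * j - 1) / (2 * n) * σ) = X * x ^ (j - 1) := by
      rw [hX, hx, ← Real.exp_nat_mul, ← Real.exp_add, Nat.cast_sub hj1]
      congr 1; push_cast; field_simp; ring
    rw [e, mul_pow]; ring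
  rw [hsum, logKernel_eq_div]
  rw [sub_eq_add_neg σ τ, Real.exp_add] at h2 ⊢
  rw [hxn]
  generalize Real.exp σ = S at h2 ⊢
  generalize Real.exp (-τ) = T at h2 h3 ⊢
  generalize a ^ n = A at ha2 h3 ⊢
  have hX0 : X ≠ 0 := (Real.exp_pos _).ne'
  generalize hd1 : 1 - a * x = d₁ at h1 ⊢
  generalize hd2 : 1 - b * (S * T) = d₂ at h2 ⊢
  generalize hd3 : 1 - A * b * T = d₃ at h3 ⊢
  field_simp
  rw [← hd2, ← hd3]
  linear_combination (-S * T) * ha2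

/-- The folded integral of the weight itself is the case `s / r = 1 / 2` of the integral
representation of `Θ`, where the two values of `Φ` coincide. -/
theorem integral_weight {a : ℝ} (ha : a = 1 ∨ a = -1) {q n : ℕ} (hq : 1 ≤ q) (hn : 1 ≤ n)
    (hqa : a = 1 → q ≠ 1) {g : ℝ → ℝ} (hgi : Integrable g)
    (hg : ∀ σ, σ ≠ 0 → g σ = σ ^ (q - 1) * Real.exp (1 / (2 * n) * σ) /
      (1 - a * Real.exp (2 * (1 / (2 * n)) * σ))) :
    ∫ σ, g σ = (n : ℝ) ^ q * ((-1) ^ (q - 1) * (Nat.factorial (q - 1) : ℝ) *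
      ((1 + a * (-1) ^ q) * lerchPhi a q (1 / 2))) := by
  have hn0 : (0 : ℝ) < n := by positivity
  have hneg : IntegrableOn (fun w => g (-w)) (Set.Ioi 0) := hgi.comp_neg.integrableOn
  obtain ⟨-, hθ⟩ := integral_theta_integrand ha hq (s := 1) (r := 2) two_pos one_pos one_lt_two
  have hΘ : lerchTheta a q 1 2 = (1 + a * (-1) ^ q) * lerchPhi a q (1 / 2) := by
    rw [lerchTheta, if_neg (fun h => hqa h.1 h.2), show ((2 : ℝ) - 1) / 2 = 1 / 2 by norm_num]
    ring
  rw [hΘ] at hθ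
  set F : ℝ → ℝ := fun w => w ^ (q - 1) * (Real.exp (1 / 2 * w) / (1 - a * Real.exp w)) +
      (-w) ^ (q - 1) * (Real.exp (-(1 / 2 * w)) / (1 - a * Real.exp (-w))) with hF
  have hscale := integral_comp_mul_left_Ioi F 0 (inv_pos.2 hn0)
  rw [mul_zero, inv_inv, hθ, smul_eq_mul] at hscale
  rw [← intervalIntegral.integral_Iic_add_Ioi hgi.integrableOn hgi.integrableOn (b := 0),
    ← neg_zero, ← integral_comp_neg_Ioi, neg_zero, ← integral_add hneg hgi.integrableOn]
  have hpt : ∀ w ∈ Set.Ioi (0 : ℝ), g (-w) + g w = (n : ℝ) ^ (q - 1) * F ((n : ℝ)⁻¹ * w) := by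
    intro w hw
    have hw' : w ≠ 0 := (Set.mem_Ioi.1 hw).ne'
    rw [hg w hw', hg (-w) (neg_ne_zero.2 hw')]
    have e1 : 1 / (2 * n) * w = 1 / 2 * ((n : ℝ)⁻¹ * w) := by field_simp
    have e2 : 2 * (1 / (2 * n)) * w = (n : ℝ)⁻¹ * w := by field_simp
    have e3 : w ^ (q - 1) = (n : ℝ) ^ (q - 1) * ((n : ℝ)⁻¹ * w) ^ (q - 1) := by
      rw [← mul_pow, mul_inv_cancel_left₀ hn0.ne']
    rw [mul_neg, mul_neg, e1, e2, neg_pow w, e3]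
    simp only [hF]
    rw [neg_pow ((n : ℝ)⁻¹ * w)]
    ring
  rw [setIntegral_congr_fun measurableSet_Ioi hpt, integral_const_mul, hscale]
  obtain ⟨m, rfl⟩ : ∃ m, q = m + 1 := ⟨q - 1, by omega⟩
  rw [Nat.add_sub_cancel, pow_succ (n : ℝ)]
  ring

/-- The inner integral after the exchange: partial fractions reduce it to finitely many
values of `Θ`. -/
theorem integral_weight_mul_logKernel {a b : ℝ} (ha : a = 1 ∨ a = -1) (hb : b = 1 ∨ b = -1)
    {q n : ℕ} (hq : 1 ≤ q) (hn : 1 ≤ n) {g : ℝ → ℝ} (hgi : Integrable g)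
    (hg : ∀ σ, σ ≠ 0 → g σ = σ ^ (q - 1) * Real.exp (1 / (2 * n) * σ) /
      (1 - a * Real.exp (2 * (1 / (2 * n)) * σ))) {τ : ℝ} (hτ : 0 < τ) :
    ∫ w in Set.Ioi (0 : ℝ), (g (τ + w) * logKernel b w + g (τ - w) * logKernel b (-w)) =
      a ^ n * (Real.exp (-τ) / (1 - a ^ n * b * Real.exp (-τ))) * ((∫ σ, g σ) -
        ∑ j ∈ Finset.Icc 1 n, a ^ (j - 1) * (Real.exp ((2 * j - 1) / (2 * n) * τ) *
          ∑ k ∈ Finset.Icc 1 q, (Nat.choose (q - 1) (k - 1) : ℝ) * τ ^ (q - k) *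
            ((-1) ^ (k - 1) * (Nat.factorial (k - 1) : ℝ) *
              lerchTheta b k (2 * (j : ℝ) - 1) (2 * (n : ℝ))))) := by
  have hn0 : (0 : ℝ) < n := by positivity
  set E : ℕ → ℕ → ℝ → ℝ := fun j k w =>
    w ^ (k - 1) * (Real.exp ((2 * j - 1) / (2 * n) * w) / (1 - b * Real.exp w)) +
      (-w) ^ (k - 1) * (Real.exp (-((2 * j - 1) / (2 * n) * w)) / (1 - b * Real.exp (-w))) with hE
  have hθ : ∀ j ∈ Finset.Icc 1 n, ∀ k ∈ Finset.Icc 1 q, IntegrableOn (E j k) (Set.Ioi 0) ∧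
      ∫ w in Set.Ioi (0 : ℝ), E j k w = (-1) ^ (k - 1) * (Nat.factorial (k - 1) : ℝ) *
        lerchTheta b k (2 * (j : ℝ) - 1) (2 * (n : ℝ)) := by
    intro j hj k hk
    rw [Finset.mem_Icc] at hj hk
    have h1 : (1 : ℝ) ≤ j := by exact_mod_cast hj.1
    have h2 : (j : ℝ) ≤ n := by exact_mod_cast hj.2
    exact integral_theta_integrand hb hk.1 (by linarith) (by linarith) (by linarith)
  have i1 : IntegrableOn (fun w => g (τ + w)) (Set.Ioi 0) := (hgi.comp_add_left τ).integrableOn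
  have i2 : IntegrableOn (fun w => g (τ - w)) (Set.Ioi 0) := (hgi.comp_sub_left τ).integrableOn
  have hwhole : ∫ w in Set.Ioi (0 : ℝ), (g (τ + w) + g (τ - w)) = ∫ σ, g σ := by
    have h0 : ∫ σ, g σ = ∫ w, g (τ + w) := (integral_add_left_eq_self g τ).symm
    have hi := hgi.comp_add_left τ
    rw [h0, ← intervalIntegral.integral_Iic_add_Ioi hi.integrableOn hi.integrableOn (b := 0),
      ← neg_zero, ← integral_comp_neg_Ioi, neg_zero, add_comm, ← integral_add i1]
    · simp [sub_eq_add_neg]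
    · simp only [sub_eq_add_neg] at i2
      exact i2
  have hae : ∀ᵐ w ∂(volume.restrict (Set.Ioi (0 : ℝ))),
      g (τ + w) * logKernel b w + g (τ - w) * logKernel b (-w) =
      a ^ n * (Real.exp (-τ) / (1 - a ^ n * b * Real.exp (-τ))) * ((g (τ + w) + g (τ - w)) -
        ∑ j ∈ Finset.Icc 1 n, a ^ (j - 1) * (Real.exp ((2 * j - 1) / (2 * n) * τ) *
          ∑ k ∈ Finset.Icc 1 q, (Nat.choose (q - 1) (k - 1) : ℝ) * τ ^ (q - k) * E j k w)) := by
    have hne : ∀ᵐ w ∂(volume.restrict (Set.Ioi (0 : ℝ))), w ≠ τ :=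
      ae_restrict_of_ae (Measure.ae_ne volume τ)
    filter_upwards [hne, ae_restrict_mem measurableSet_Ioi] with w hwτ hw
    have hw0 : 0 < w := hw
    have n1 : τ + w ≠ 0 := by positivity
    have n2 : τ - w ≠ 0 := sub_ne_zero.2 hwτ.symm
    have f1 := partial_fractions ha hb hn n1 hτ (by linarith : τ + w > τ).ne'
    have f2 := partial_fractions ha hb hn n2 hτ (by linarith : τ - w < τ).ne
    rw [show τ + w - τ = w by ring] at f1
    rw [show τ - w - τ = -w by ring] at f2
    have hsum : ∀ j : ℕ, Real.exp ((2 * j - 1) / (2 * n) * τ) *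
        ∑ k ∈ Finset.Icc 1 q, (Nat.choose (q - 1) (k - 1) : ℝ) * τ ^ (q - k) * E j k w =
        (τ + w) ^ (q - 1) *
          (Real.exp ((2 * j - 1) / (2 * n) * (τ + w)) / (1 - b * Real.exp w)) +
        (τ - w) ^ (q - 1) *
          (Real.exp ((2 * j - 1) / (2 * n) * (τ - w)) / (1 - b * Real.exp (-w))) := by
      intro j
      rw [add_pow_eq_sum_Icc τ w hq, sub_eq_add_neg τ w, add_pow_eq_sum_Icc τ (-w) hq, mul_add,
        mul_add, Real.exp_add, Real.exp_add, mul_neg, Finset.mul_sum, Finset.sum_mul,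
        Finset.sum_mul, ← Finset.sum_add_distrib]
      refine Finset.sum_congr rfl fun k _ => ?_
      simp only [hE]
      ring
    simp_rw [hsum]
    rw [hg _ n1, hg _ n2, mul_div_assoc, mul_div_assoc]
    simp_rw [mul_add (a ^ (_ - 1)), Finset.sum_add_distrib]
    have s1 : ∑ j ∈ Finset.Icc 1 n, a ^ (j - 1) * ((τ + w) ^ (q - 1) *
          (Real.exp ((2 * j - 1) / (2 * n) * (τ + w)) / (1 - b * Real.exp w))) =
        (τ + w) ^ (q - 1) * ∑ j ∈ Finset.Icc 1 n, a ^ (j - 1) *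
          (Real.exp ((2 * j - 1) / (2 * n) * (τ + w)) / (1 - b * Real.exp w)) := by
      rw [Finset.mul_sum]; refine Finset.sum_congr rfl fun j _ => by ring
    have s2 : ∑ j ∈ Finset.Icc 1 n, a ^ (j - 1) * ((τ - w) ^ (q - 1) *
          (Real.exp ((2 * j - 1) / (2 * n) * (τ - w)) / (1 - b * Real.exp (-w)))) =
        (τ - w) ^ (q - 1) * ∑ j ∈ Finset.Icc 1 n, a ^ (j - 1) *
          (Real.exp ((2 * j - 1) / (2 * n) * (τ - w)) / (1 - b * Real.exp (-w))) := by
      rw [Finset.mul_sum]; refine Finset.sum_congr rfl fun j _ => by ring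
    rw [s1, s2]
    linear_combination (τ + w) ^ (q - 1) * f1 + (τ - w) ^ (q - 1) * f2
  have iE : ∀ j ∈ Finset.Icc 1 n, IntegrableOn (fun w => ∑ k ∈ Finset.Icc 1 q,
      (Nat.choose (q - 1) (k - 1) : ℝ) * τ ^ (q - k) * E j k w) (Set.Ioi 0) := fun j hj =>
    integrable_finsetSum _ fun k hk => (hθ j hj k hk).1.const_mul _
  have iS : IntegrableOn (fun w => ∑ j ∈ Finset.Icc 1 n, a ^ (j - 1) *
      (Real.exp ((2 * j - 1) / (2 * n) * τ) * ∑ k ∈ Finset.Icc 1 q,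
        (Nat.choose (q - 1) (k - 1) : ℝ) * τ ^ (q - k) * E j k w)) (Set.Ioi 0) :=
    integrable_finsetSum _ fun j hj => ((iE j hj).const_mul _).const_mul _
  have i3 : IntegrableOn (fun w => g (τ + w) + g (τ - w)) (Set.Ioi 0) := i1.add i2
  rw [integral_congr_ae hae, integral_const_mul, integral_sub i3 iS, hwhole,
    integral_finsetSum _ (fun j hj => ((iE j hj).const_mul _).const_mul _)]
  congr 2
  refine Finset.sum_congr rfl fun j hj => ?_
  rw [integral_const_mul, integral_const_mul,
    integral_finsetSum _ (fun k hk => (hθ j hj k hk).1.const_mul _)]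
  congr 2
  refine Finset.sum_congr rfl fun k hk => ?_
  rw [integral_const_mul, (hθ j hj k hk).2]

theorem choose_mul_factorial_eq {p q k : ℕ} (hp : 1 ≤ p) (hk1 : 1 ≤ k) (hkq : k ≤ q) :
    (Nat.choose (q - 1) (k - 1) : ℝ) * (Nat.factorial (k - 1) : ℝ) *
        (Nat.factorial (p + q - k - 1) : ℝ) =
      (Nat.factorial (q - 1) : ℝ) * (Nat.choose (p + q - k - 1) (p - 1) : ℝ) *
        (Nat.factorial (p - 1) : ℝ) := by
  have h1 := Nat.choose_mul_factorial_mul_factorial (n := q - 1) (k := k - 1) (by omega)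
  have h2 := Nat.choose_mul_factorial_mul_factorial (n := p + q - k - 1) (k := p - 1) (by omega)
  rw [show q - 1 - (k - 1) = q - k by omega] at h1
  rw [show p + q - k - 1 - (p - 1) = q - k by omega] at h2
  rw [← h1, ← h2]
  push_cast
  ring

theorem integral_Ioi_eq_exp_mul {β : ℝ} (hβ : 0 < β) (f : ℝ → ℝ) :
    (IntegrableOn f (Set.Ioi 0) ↔ Integrable fun σ => β * Real.exp (β * σ) * f (Real.exp (β * σ))) ∧
    ∫ x in Set.Ioi (0 : ℝ), f x = ∫ σ, β * Real.exp (β * σ) * f (Real.exp (β * σ)) := by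
  have him : (fun σ => Real.exp (β * σ)) '' Set.univ = Set.Ioi 0 := by
    rw [Set.image_univ]
    ext x
    refine ⟨?_, fun hx => ⟨Real.log x / β, ?_⟩⟩
    · rintro ⟨σ, rfl⟩; exact Real.exp_pos _
    · have hx' : 0 < x := hx
      simp only [mul_div_cancel₀ _ hβ.ne', Real.exp_log hx']
  have hd : ∀ σ ∈ (Set.univ : Set ℝ), HasDerivWithinAt (fun σ => Real.exp (β * σ))
      (β * Real.exp (β * σ)) Set.univ σ := by
    intro σ _
    have h : HasDerivAt (fun σ => β * σ) β σ := by simpa using (hasDerivAt_id σ).const_mul β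
    exact (h.exp.congr_deriv (mul_comm _ _)).hasDerivWithinAt
  have hinj : Set.InjOn (fun σ => Real.exp (β * σ)) Set.univ := by
    intro x _ y _ h
    exact mul_left_cancel₀ hβ.ne' (Real.exp_injective h)
  have habs : ∀ σ, |β * Real.exp (β * σ)| = β * Real.exp (β * σ) := fun σ =>
    abs_of_pos (by positivity)
  constructor
  · rw [← him, integrableOn_image_iff_integrableOn_abs_deriv_smul MeasurableSet.univ hd hinj,
      integrableOn_univ]
    simp only [habs, smul_eq_mul]
  · rw [← him, integral_image_eq_integral_abs_deriv_smul MeasurableSet.univ hd hinj,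
      setIntegral_univ]
    simp only [habs, smul_eq_mul]

theorem theorem2 (p q n : ℕ) (hp : 1 ≤ p) (hq : 1 ≤ q) (hn : 1 ≤ n)
    (a b : ℝ) (ha : a = 1 ∨ a = -1) (hb : b = 1 ∨ b = -1)
    (hpab : a ^ n * b = 1 → p ≠ 1) (hqa : a = 1 → q ≠ 1) :
    IntegrableOn
      (fun x : ℝ => Real.log x ^ (q - 1) * polylog p (b * x ^ (2 * n)) / (1 - a * x ^ 2))
      (Set.Ioi 0) volume ∧
    ∫ x in Set.Ioi (0 : ℝ),
        Real.log x ^ (q - 1) * polylog p (b * x ^ (2 * n)) / (1 - a * x ^ 2) =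
      -(a ^ (n - 1) * b * ((2 : ℝ) ^ q)⁻¹ * (Nat.factorial (q - 1) : ℝ) * (1 + a * (-1) ^ q) *
          lerchPhi a q (1 / 2) * lerchPhi (a ^ n * b) p 1) +
        a ^ (n - 1) * b * ((2 * (n : ℝ)) ^ q)⁻¹ * (Nat.factorial (q - 1) : ℝ) *
          ∑ j ∈ Finset.Icc 1 n, ∑ k ∈ Finset.Icc 1 q,
            (Nat.choose (p + q - k - 1) (p - 1) : ℝ) * a ^ j * (-1) ^ k *
              lerchTheta b k (2 * (j : ℝ) - 1) (2 * (n : ℝ)) *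
              lerchPhi (a ^ n * b) (p + q - k)
                ((2 * (n : ℝ) - 2 * (j : ℝ) + 1) / (2 * (n : ℝ))) := by
  have hn0 : (0 : ℝ) < n := by positivity
  have hn1 : (1 : ℝ) ≤ n := by exact_mod_cast hn
  set β : ℝ := 1 / (2 * n) with hβdef
  have hβ : 0 < β := by positivity
  have hβ1 : β / 2 < 1 := by
    have : β ≤ 1 := by rw [hβdef, div_le_one (by positivity)]; linarith
    linarith
  obtain ⟨g, C, hg, hgeq⟩ := exists_expDecay_weight ha hq hqa hβ
  have hgi : Integrable g := hg.integrable (by positivity)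
  obtain ⟨hint, hval⟩ := hg.integral_mul_polylog (by positivity) hβ1 hb p
  have hc : a ^ n * b = 1 ∨ a ^ n * b = -1 := by
    rcases pow_eq_one_or_neg_one ha n with h | h <;> rcases hb with rfl | rfl <;> simp [h]
  -- In `x = e ^ (β σ)`, the powers of `β` from `dx` and from `log x` combine to `β ^ q`.
  have hsub : (fun σ => β * Real.exp (β * σ) * (Real.log (Real.exp (β * σ)) ^ (q - 1) *
      polylog p (b * Real.exp (β * σ) ^ (2 * n)) / (1 - a * Real.exp (β * σ) ^ 2))) =ᵐ[volume]
      fun σ => β ^ q * (g σ * polylog p (b * Real.exp σ)) := by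
    filter_upwards [Measure.ae_ne volume (0 : ℝ)] with σ hσ
    have e1 : Real.exp (β * σ) ^ (2 * n) = Real.exp σ := by
      rw [← Real.exp_nat_mul, hβdef]; congr 1; push_cast; field_simp
    have e2 : Real.exp (β * σ) ^ 2 = Real.exp (2 * β * σ) := by
      rw [← Real.exp_nat_mul]; congr 1; push_cast; ring
    obtain ⟨m, rfl⟩ : ∃ m, q = m + 1 := ⟨q - 1, by omega⟩
    rw [hgeq σ hσ, Real.log_exp, e1, e2, Nat.add_sub_cancel, mul_pow]
    ring
  obtain ⟨hiff, heq⟩ := integral_Ioi_eq_exp_mul hβ (fun x : ℝ => Real.log x ^ (q - 1) *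
    polylog p (b * x ^ (2 * n)) / (1 - a * x ^ 2))
  refine ⟨hiff.2 ((hint.const_mul _).congr hsub.symm), ?_⟩
  rw [heq, integral_congr_ae hsub, integral_const_mul, hval]
  have hτint : ∀ (m : ℕ), 1 ≤ m → ¬ (a ^ n * b = 1 ∧ m = 1) → ∀ α : ℝ, 0 < α →
      IntegrableOn (fun τ : ℝ => τ ^ (m - 1) * Real.exp (-(α * τ)) /
        (1 - a ^ n * b * Real.exp (-τ))) (Set.Ioi 0) ∧
      ∫ τ in Set.Ioi (0 : ℝ), τ ^ (m - 1) * Real.exp (-(α * τ)) /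
        (1 - a ^ n * b * Real.exp (-τ)) =
        (Nat.factorial (m - 1) : ℝ) * lerchPhi (a ^ n * b) m α := fun m hm h α hα =>
    ⟨integrableOn_lerch_integrand hc hm h hα, lerchPhi_eq_integral hc hm h hα⟩
  obtain ⟨i0, v0⟩ := hτint p hp (fun h => hpab h.1 h.2) 1 one_pos
  set L : ℕ → ℕ → ℝ → ℝ := fun j k τ => τ ^ (p + q - k - 1) *
    Real.exp (-((2 * n - 2 * j + 1) / (2 * n) * τ)) / (1 - a ^ n * b * Real.exp (-τ)) with hL
  have hLint : ∀ j ∈ Finset.Icc 1 n, ∀ k ∈ Finset.Icc 1 q, IntegrableOn (L j k) (Set.Ioi 0) ∧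
      ∫ τ in Set.Ioi (0 : ℝ), L j k τ = (Nat.factorial (p + q - k - 1) : ℝ) *
        lerchPhi (a ^ n * b) (p + q - k) ((2 * (n : ℝ) - 2 * (j : ℝ) + 1) / (2 * (n : ℝ))) := by
    intro j hj k hk
    rw [Finset.mem_Icc] at hj hk
    have h2 : (j : ℝ) ≤ n := by exact_mod_cast hj.2
    have hpk : ¬ (a ^ n * b = 1 ∧ p + q - k = 1) := by
      rintro ⟨h, h'⟩
      exact hpab h (by omega)
    exact hτint (p + q - k) (by omega) hpk _ (div_pos (by linarith) (by positivity))
  set G : ℝ := ∫ σ, g σ with hG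
  set J : ℕ → ℕ → ℝ := fun j k => (Nat.choose (q - 1) (k - 1) : ℝ) *
    ((-1) ^ (k - 1) * (Nat.factorial (k - 1) : ℝ) *
      lerchTheta b k (2 * (j : ℝ) - 1) (2 * (n : ℝ))) with hJ
  have hpt : ∀ τ ∈ Set.Ioi (0 : ℝ), τ ^ (p - 1) * ∫ w in Set.Ioi (0 : ℝ),
      (g (τ + w) * logKernel b w + g (τ - w) * logKernel b (-w)) =
      a ^ n * (G * (τ ^ (p - 1) * Real.exp (-(1 * τ)) / (1 - a ^ n * b * Real.exp (-τ))) -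
        ∑ j ∈ Finset.Icc 1 n, ∑ k ∈ Finset.Icc 1 q, a ^ (j - 1) * J j k * L j k τ) := by
    intro τ hτ
    rw [integral_weight_mul_logKernel ha hb hq hn hgi hgeq hτ]
    have hexp : ∀ j : ℕ, Real.exp (-((2 * n - 2 * j + 1) / (2 * n) * τ)) =
        Real.exp (-τ) * Real.exp ((2 * j - 1) / (2 * n) * τ) := by
      intro j; rw [← Real.exp_add]; congr 1; field_simp; ring
    have hS : ∑ j ∈ Finset.Icc 1 n, ∑ k ∈ Finset.Icc 1 q, a ^ (j - 1) * J j k * L j k τ =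
        τ ^ (p - 1) * (Real.exp (-τ) / (1 - a ^ n * b * Real.exp (-τ))) *
        ∑ j ∈ Finset.Icc 1 n, a ^ (j - 1) * (Real.exp ((2 * j - 1) / (2 * n) * τ) *
          ∑ k ∈ Finset.Icc 1 q, (Nat.choose (q - 1) (k - 1) : ℝ) * τ ^ (q - k) *
            ((-1) ^ (k - 1) * (Nat.factorial (k - 1) : ℝ) *
              lerchTheta b k (2 * (j : ℝ) - 1) (2 * (n : ℝ)))) := by
      rw [Finset.mul_sum]
      refine Finset.sum_congr rfl fun j _ => ?_
      rw [Finset.mul_sum, Finset.mul_sum, Finset.mul_sum]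
      refine Finset.sum_congr rfl fun k hk => ?_
      have hkq := (Finset.mem_Icc.1 hk).2
      simp only [hL, hJ]
      rw [hexp, show p + q - k - 1 = (p - 1) + (q - k) by omega, pow_add]
      ring
    rw [hS, one_mul]
    ring
  have iS : ∀ j ∈ Finset.Icc 1 n, IntegrableOn (fun τ => ∑ k ∈ Finset.Icc 1 q,
      a ^ (j - 1) * J j k * L j k τ) (Set.Ioi 0) := fun j hj =>
    integrable_finsetSum _ fun k hk => (hLint j hj k hk).1.const_mul _
  rw [setIntegral_congr_fun measurableSet_Ioi hpt, integral_const_mul,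
    integral_sub (i0.const_mul G) (integrable_finsetSum _ iS), integral_const_mul, v0,
    integral_finsetSum _ iS, hG, integral_weight ha hq hn hqa hgi hgeq]
  have hp0 : (Nat.factorial (p - 1) : ℝ) ≠ 0 := by positivity
  have ha2 : a * a = 1 := by rcases ha with rfl | rfl <;> norm_num
  have han : a ^ n = a ^ (n - 1) * a := by rw [← pow_succ, Nat.sub_add_cancel hn]
  have hSum : ∑ j ∈ Finset.Icc 1 n, ∫ τ in Set.Ioi (0 : ℝ), ∑ k ∈ Finset.Icc 1 q,
      a ^ (j - 1) * J j k * L j k τ =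
      -(a * (Nat.factorial (p - 1) : ℝ) * (Nat.factorial (q - 1) : ℝ) *
        ∑ j ∈ Finset.Icc 1 n, ∑ k ∈ Finset.Icc 1 q,
            (Nat.choose (p + q - k - 1) (p - 1) : ℝ) * a ^ j * (-1) ^ k *
              lerchTheta b k (2 * (j : ℝ) - 1) (2 * (n : ℝ)) *
              lerchPhi (a ^ n * b) (p + q - k)
                ((2 * (n : ℝ) - 2 * (j : ℝ) + 1) / (2 * (n : ℝ)))) := by
    rw [Finset.mul_sum, ← Finset.sum_neg_distrib]
    refine Finset.sum_congr rfl fun j hj => ?_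
    rw [integral_finsetSum _ (fun k hk => (hLint j hj k hk).1.const_mul _), Finset.mul_sum,
      ← Finset.sum_neg_distrib]
    refine Finset.sum_congr rfl fun k hk => ?_
    rw [integral_const_mul, (hLint j hj k hk).2]
    have hj1 := (Finset.mem_Icc.1 hj).1
    have hk1 := (Finset.mem_Icc.1 hk).1
    have hf := choose_mul_factorial_eq hp hk1 (Finset.mem_Icc.1 hk).2
    have e1 : a ^ j = a ^ (j - 1) * a := by rw [← pow_succ, Nat.sub_add_cancel hj1]
    have e2 : (-1 : ℝ) ^ k = (-1) ^ (k - 1) * -1 := by rw [← pow_succ, Nat.sub_add_cancel hk1]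
    simp only [hJ]
    rw [e1, e2]
    generalize lerchTheta b k (2 * (j : ℝ) - 1) (2 * (n : ℝ)) = Θ
    generalize lerchPhi (a ^ n * b) (p + q - k)
      ((2 * (n : ℝ) - 2 * (j : ℝ) + 1) / (2 * (n : ℝ))) = Φ
    linear_combination (a ^ (j - 1) * (-1) ^ (k - 1) * Θ * Φ) * hf -
      ((Nat.factorial (q - 1) : ℝ) * (Nat.choose (p + q - k - 1) (p - 1) : ℝ) *
        (Nat.factorial (p - 1) : ℝ) * a ^ (j - 1) * (-1) ^ (k - 1) * Θ * Φ) * ha2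
  rw [hSum]
  have e3 : β ^ q * (n : ℝ) ^ q = ((2 : ℝ) ^ q)⁻¹ := by
    rw [← mul_pow, ← inv_pow, hβdef]; congr 1; field_simp
  have e4 : β ^ q = ((2 * (n : ℝ)) ^ q)⁻¹ := by rw [hβdef, one_div, inv_pow]
  have e5 : a * (-1) ^ (q - 1) * (1 + a * (-1) ^ q) = -(1 + a * (-1) ^ q) := by
    obtain ⟨m, rfl⟩ : ∃ m, q = m + 1 := ⟨q - 1, by omega⟩
    have hsq : ((-1 : ℝ) ^ m) * (-1) ^ m = 1 := by rw [← mul_pow]; norm_num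
    rw [Nat.add_sub_cancel, pow_succ]
    linear_combination (-(a * a)) * hsq - ha2
  generalize (∑ j ∈ Finset.Icc 1 n, ∑ k ∈ Finset.Icc 1 q,
            (Nat.choose (p + q - k - 1) (p - 1) : ℝ) * a ^ j * (-1) ^ k *
              lerchTheta b k (2 * (j : ℝ) - 1) (2 * (n : ℝ)) *
              lerchPhi (a ^ n * b) (p + q - k)
                ((2 * (n : ℝ) - 2 * (j : ℝ) + 1) / (2 * (n : ℝ)))) = S
  rw [← e3, ← e4]
  clear_value β
  generalize lerchPhi (a ^ n * b) p 1 = Φ₁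
  generalize lerchPhi a q (1 / 2) = Φ₂
  rw [han, div_eq_mul_inv]
  have hP := inv_mul_cancel₀ hp0
  linear_combination (β ^ q * b * (a ^ (n - 1) * a) * ((n : ℝ) ^ q * (-1) ^ (q - 1) *
      (Nat.factorial (q - 1) : ℝ) * (1 + a * (-1) ^ q) * Φ₂ * Φ₁ +
        a * (Nat.factorial (q - 1) : ℝ) * S)) * hP +
    (a ^ (n - 1) * b * β ^ q * (n : ℝ) ^ q * (Nat.factorial (q - 1) : ℝ) * Φ₁ * Φ₂) * e5 +
    (a ^ (n - 1) * b * β ^ q * (Nat.factorial (q - 1) : ℝ) * S) * ha2
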